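/- Let $m>0$ and $b>0$, and let $$\gamma^0=\begin{pmatrix}1&0\\0&-1\end{pmatrix},\qquad \gamma^1=\begin{pmatrix}0&i\\i&0\end{pmatrix},\qquad \gamma^2=\begin{pmatrix}0&1\\-1&0\end{pmatrix},\qquad \alpha^j=\gamma^0\gamma^j\ (j=1,2).$$ Let $\mathcal D_m=-i(\alpha^1\partial_1+\alpha^2\partial_2)+m\gamma^0$ be the free Dirac operator on $L^2(\mathbb R^2;\mathbb C^2)$, and $e^{-it\mathcal D_m}$ the unitary group that it generates. Then for every $s>0$ and every $\psi_0\in H^s(\mathbb R^2;\mathbb C^2)$ (of arbitrary size) there is exactly one $\psi\in C([0,\infty);H^s(\mathbb R^2;\mathbb C^2))$ such that, for all $t\ge 0$, $$\psi(t)=e^{-it\mathcal D_m}\psi_0+i\int_0^t e^{-i(t-\tau)\mathcal D_m}\Big[\big((b-\Delta)^{-1}|\psi(\tau)|^2\big)\gamma^0\psi(\tau)\Big]\,d\tau ,$$ where the integral converges absolutely in $L^2(\mathbb R^2;\mathbb C^2)$ and $(b-\Delta)^{-1}$ is the Fourier multiplier with symbol $(b+|\xi|^2)^{-1}$. Moreover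 $\|\psi(t)\|_{L^2(\mathbb R^2)}=\|\psi_0\|_{L^2(\mathbb R^2)}$ for all $t\ge 0$. -/

import Mathlib

open MeasureTheory FourierTransform Filter Topology
open scoped ENNReal SchwartzMap

noncomputable section

namespace DiracHartree

/-- The plane `ℝ²` with its Euclidean norm. -/
abbrev Plane : Type := EuclideanSpace ℝ (Fin 2)

/-- The space `ℂ²` of spinors with its Hermitian norm. -/
abbrev Spinor : Type := EuclideanSpace ℂ (Fin 2)

/-- The Hilbert space `L²(ℝ²; ℂ²)`. -/
abbrev L2 : Type := Lp Spinor 2 (volume : Measure Plane)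

/-! ### The Sobolev spaces `H^s(ℝ²; ℂ²)`, `s ≥ 0` -/

/-- The function `f ∈ L²(ℝ²; ℂ²)` belongs to `H^s(ℝ²; ℂ²)`. -/
def MemHs (s : ℝ) (f : L2) : Prop :=
  TemperedDistribution.MemSobolev s 2 (f : 𝓢'(Plane, Spinor))

/-- The norm of `H^s(ℝ²; ℂ²)`, that is `‖(1 - Δ)^{s/2} f‖_{L²}`, computed by Plancherel's theorem
(the frequency variable of Mathlib's Fourier transform is `ξ` with `-Δ` acting as `(2π|ξ|)²`). It
takes values in `[0, ∞]` and is finite exactly on `H^s`, see `hsNorm_lt_top_iff`. -/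
def hsNorm (s : ℝ) (f : L2) : ℝ≥0∞ :=
  eLpNorm (fun ξ : Plane ↦ ((1 + (2 * Real.pi * ‖ξ‖) ^ 2) ^ (s / 2) : ℝ) • (𝓕 f : L2) ξ) 2 volume

theorem hsNorm_lt_top_iff (s : ℝ) (f : L2) : hsNorm s f < ∞ ↔ MemHs s f := by
  rw [MemHs, TemperedDistribution.memSobolev_iff_exists_smulLeftCLM_fourier,
    Lp.fourier_toTemperedDistribution_eq]
  generalize hg : (𝓕 f : L2) = g
  rw [hsNorm, hg]
  have hw : (fun x : Plane ↦ (((1 + ‖x‖ ^ 2) ^ (s / 2) : ℝ) : ℂ)).HasTemperateGrowth := by fun_prop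
  have hmeas : ∀ c : ℝ, 0 < c → AEStronglyMeasurable
      (fun ξ : Plane ↦ ((1 + (c * ‖ξ‖) ^ 2) ^ (s / 2) : ℝ) • g ξ) volume := by
    intro c hc
    have h : Continuous fun ξ : Plane ↦ (1 + (c * ‖ξ‖) ^ 2) ^ (s / 2) :=
      Continuous.rpow_const (by fun_prop) fun x ↦ Or.inl (by positivity)
    exact h.aestronglyMeasurable.smul (Lp.aestronglyMeasurable g)
  -- changing the constant in the weight gives an equivalent norm
  have hcomp : ∀ c d : ℝ, 0 < c → 0 < d →
      MemLp (fun ξ : Plane ↦ ((1 + (c * ‖ξ‖) ^ 2) ^ (s / 2) : ℝ) • g ξ) 2 volume →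
      MemLp (fun ξ : Plane ↦ ((1 + (d * ‖ξ‖) ^ 2) ^ (s / 2) : ℝ) • g ξ) 2 volume := by
    intro c d hc hd h
    have key : ∀ c d : ℝ, 0 < c → 0 < d → ∀ r : ℝ, 0 ≤ r →
        1 + (d * r) ^ 2 ≤ (1 + (d / c) ^ 2) * (1 + (c * r) ^ 2) := by
      intro c d hc hd r hr
      have : (d / c) ^ 2 * (c * r) ^ 2 = (d * r) ^ 2 := by field_simp
      nlinarith [sq_nonneg (d / c), sq_nonneg (c * r)]
    have : ∃ K : ℝ, ∀ r : ℝ, 0 ≤ r →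
        (1 + (d * r) ^ 2) ^ (s / 2) ≤ K * (1 + (c * r) ^ 2) ^ (s / 2) := by
      rcases le_total 0 (s / 2) with hs | hs
      · refine ⟨(1 + (d / c) ^ 2) ^ (s / 2), fun r hr ↦ ?_⟩
        rw [← Real.mul_rpow (by positivity) (by positivity)]
        exact Real.rpow_le_rpow (by positivity) (key c d hc hd r hr) hs
      · refine ⟨(1 + (c / d) ^ 2) ^ (-(s / 2)), fun r hr ↦ ?_⟩
        have h1 := Real.rpow_le_rpow (by positivity) (key d c hd hc r hr)
          (neg_nonneg.2 hs)
        rw [Real.mul_rpow (by positivity) (by positivity)] at h1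
        rw [Real.rpow_neg (x := 1 + (c * r) ^ 2) (by positivity),
          Real.rpow_neg (x := 1 + (d * r) ^ 2) (by positivity)] at h1
        have p1 : 0 < (1 + (c * r) ^ 2) ^ (s / 2) := by positivity
        have p2 : 0 < (1 + (d * r) ^ 2) ^ (s / 2) := by positivity
        rw [inv_le_iff_one_le_mul₀ p1] at h1
        rw [mul_assoc, mul_left_comm, inv_mul_eq_div, le_div_iff₀ p2, one_mul] at h1
        linarith [mul_comm ((1 + (c * r) ^ 2) ^ (s / 2)) ((1 + (c / d) ^ 2) ^ (-(s / 2)))]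
    obtain ⟨K, hK⟩ := this
    refine h.of_le_mul (c := K) (hmeas d hd) (Eventually.of_forall fun ξ ↦ ?_)
    rw [norm_smul, norm_smul, ← mul_assoc]
    refine mul_le_mul_of_nonneg_right ?_ (norm_nonneg _)
    rw [Real.norm_of_nonneg (by positivity), Real.norm_of_nonneg (by positivity)]
    exact hK _ (norm_nonneg _)
  have hiff : MemLp (fun ξ : Plane ↦ ((1 + ‖ξ‖ ^ 2) ^ (s / 2) : ℝ) • g ξ) 2 volume ↔
      eLpNorm (fun ξ : Plane ↦ ((1 + (2 * Real.pi * ‖ξ‖) ^ 2) ^ (s / 2) : ℝ) • g ξ) 2 volume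
        < ∞ := by
    have h1 : (fun ξ : Plane ↦ ((1 + ‖ξ‖ ^ 2) ^ (s / 2) : ℝ) • g ξ) =
        fun ξ : Plane ↦ ((1 + (1 * ‖ξ‖) ^ 2) ^ (s / 2) : ℝ) • g ξ := by simp
    rw [h1]
    exact ⟨fun h ↦ (hcomp 1 _ one_pos (by positivity) h).2,
      fun h ↦ hcomp _ 1 (by positivity) one_pos ⟨hmeas _ (by positivity), h⟩⟩
  rw [← hiff]
  constructor
  · intro h
    refine ⟨h.toLp _, ?_⟩
    ext1 u
    simp only [TemperedDistribution.smulLeftCLM_apply_apply, Lp.toTemperedDistribution_apply]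
    refine integral_congr_ae ?_
    filter_upwards [h.coeFn_toLp] with x hx
    rw [hx, SchwartzMap.smulLeftCLM_apply_apply hw, ← Complex.coe_smul, smul_smul, smul_eq_mul,
      mul_comm]
  · rintro ⟨f', hf'⟩
    have hae : ∀ᵐ x : Plane, ((1 + ‖x‖ ^ 2) ^ (s / 2) : ℝ) • g x = f' x := by
      refine ae_eq_of_integral_contDiff_smul_eq ?_
        ((Lp.memLp f').locallyIntegrable one_le_two) ?_
      · refine ((Lp.memLp g).locallyIntegrable one_le_two).continuous_smul ?_
        exact Continuous.rpow_const (by fun_prop) fun x ↦ Or.inl (by positivity)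
      · intro u hu hc
        have hg₁ : HasCompactSupport (Complex.ofRealCLM ∘ u) := hc.comp_left rfl
        have hg₂ : ContDiff ℝ ((⊤ : ℕ∞) : WithTop ℕ∞) (Complex.ofRealCLM ∘ u) := by fun_prop
        have := congrArg (fun T : 𝓢'(Plane, Spinor) ↦ T (hg₁.toSchwartzMap hg₂)) hf'
        simp only [TemperedDistribution.smulLeftCLM_apply_apply,
          Lp.toTemperedDistribution_apply, SchwartzMap.smulLeftCLM_apply_apply hw] at this
        simpa [smul_smul, mul_comm, ← Complex.ofReal_mul] using this
    exact (memLp_congr_ae hae).2 (Lp.memLp f')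

/-- `ψ ∈ C([0, ∞); H^s(ℝ²; ℂ²))`. The values of `ψ` at negative times play no role. -/
def ContinuousInHs (s : ℝ) (ψ : ℝ → L2) : Prop :=
  (∀ t, 0 ≤ t → MemHs s (ψ t)) ∧
    ∀ t₀, 0 ≤ t₀ →
      Tendsto (fun t ↦ hsNorm s (ψ t - ψ t₀)) (𝓝[Set.Ici 0] t₀) (𝓝 0)

/-! ### The free Dirac propagator -/

/-- The Dirac matrix `γ⁰`. -/
def gamma0 : Matrix (Fin 2) (Fin 2) ℂ := !![1, 0; 0, -1]

/-- The Dirac matrix `γ¹`. -/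
def gamma1 : Matrix (Fin 2) (Fin 2) ℂ := !![0, Complex.I; Complex.I, 0]

/-- The Dirac matrix `γ²`. -/
def gamma2 : Matrix (Fin 2) (Fin 2) ℂ := !![0, 1; -1, 0]

/-- The matrix `α¹ = γ⁰ γ¹`. -/
def alpha1 : Matrix (Fin 2) (Fin 2) ℂ := gamma0 * gamma1

/-- The matrix `α² = γ⁰ γ²`. -/
def alpha2 : Matrix (Fin 2) (Fin 2) ℂ := gamma0 * gamma2

/-- The symbol of the Dirac operator `D_m = -i α^j ∂_j + m γ⁰`: in Mathlib's convention `∂_j` has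
the symbol `2πi ξ_j`, so `-i ∂_j` has the symbol `2π ξ_j`. -/
def diracSymbol (m : ℝ) (ξ : Plane) : Matrix (Fin 2) (Fin 2) ℂ :=
  ((2 * Real.pi * ξ 0 : ℝ) : ℂ) • alpha1 + ((2 * Real.pi * ξ 1 : ℝ) : ℂ) • alpha2
    + (m : ℂ) • gamma0

/-- The symbol `exp(-i t D_m(ξ))` of the free propagator `e^{-i t D_m}`. -/
def propagatorSymbol (m t : ℝ) (ξ : Plane) : Matrix (Fin 2) (Fin 2) ℂ :=
  NormedSpace.exp ((-(Complex.I * (t : ℂ))) • diracSymbol m ξ)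

/-- The action of a complex `2 × 2` matrix on spinors. -/
def act (M : Matrix (Fin 2) (Fin 2) ℂ) : Spinor →L[ℂ] Spinor :=
  Matrix.toEuclideanCLM (n := Fin 2) (𝕜 := ℂ) M

theorem isHermitian_diracSymbol (m : ℝ) (ξ : Plane) : (diracSymbol m ξ).IsHermitian := by
  ext i j
  fin_cases i <;> fin_cases j <;>
    simp [diracSymbol, Matrix.conjTranspose_apply, alpha1, alpha2, gamma0, gamma1, gamma2]

theorem continuous_act_propagatorSymbol (m t : ℝ) :
    Continuous fun ξ ↦ act (propagatorSymbol m t ξ) := by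
  have hL : Continuous (Matrix.toEuclideanCLM (n := Fin 2) (𝕜 := ℂ)) :=
    LinearMap.continuous_of_finiteDimensional
      (Matrix.toEuclideanCLM (n := Fin 2) (𝕜 := ℂ)).toAlgEquiv.toLinearMap
  refine hL.comp ?_
  have h : Continuous (diracSymbol m) := by
    unfold diracSymbol
    fun_prop
  let _ : NormedRing (Matrix (Fin 2) (Fin 2) ℂ) := Matrix.linftyOpNormedRing
  let _ : NormedAlgebra ℂ (Matrix (Fin 2) (Fin 2) ℂ) := Matrix.linftyOpNormedAlgebra
  let _ : NormedAlgebra ℚ (Matrix (Fin 2) (Fin 2) ℂ) := .restrictScalars ℚ ℂ _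
  exact NormedSpace.exp_continuous.comp (h.const_smul (-(Complex.I * (t : ℂ))))

theorem norm_act_propagatorSymbol (m t : ℝ) (ξ : Plane) (v : Spinor) :
    ‖act (propagatorSymbol m t ξ) v‖ = ‖v‖ := by
  have hs : ((-(Complex.I * (t : ℂ))) • diracSymbol m ξ).conjTranspose
      = -((-(Complex.I * (t : ℂ))) • diracSymbol m ξ) := by
    rw [Matrix.conjTranspose_smul, (isHermitian_diracSymbol m ξ).eq]
    simp
  have hu : propagatorSymbol m t ξ ∈ unitary (Matrix (Fin 2) (Fin 2) ℂ) := by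
    rw [propagatorSymbol]
    generalize (-(Complex.I * (t : ℂ))) • diracSymbol m ξ = A at hs
    rw [Unitary.mem_iff, Matrix.star_eq_conjTranspose, ← Matrix.exp_conjTranspose, hs,
      ← Matrix.exp_add_of_commute _ _ (Commute.refl A).neg_left,
      ← Matrix.exp_add_of_commute _ _ (Commute.refl A).neg_right,
      neg_add_cancel, add_neg_cancel, NormedSpace.exp_zero, and_self_iff]
  exact ContinuousLinearMap.norm_map_of_mem_unitary (Unitary.map_mem _ hu) v

theorem aestronglyMeasurable_clm_apply {T : Plane → Spinor →L[ℂ] Spinor} (hT : Continuous T)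
    {f : Plane → Spinor} (hf : AEStronglyMeasurable f volume) :
    AEStronglyMeasurable (fun ξ ↦ T ξ (f ξ)) volume :=
  (isBoundedBilinearMap_apply (𝕜 := ℂ) (E := Spinor) (F := Spinor)).continuous.comp_aestronglyMeasurable
    (hT.aestronglyMeasurable.prodMk hf)

theorem memLp_propagatorSymbol (m t : ℝ) (f : L2) :
    MemLp (fun ξ ↦ act (propagatorSymbol m t ξ) (f ξ)) 2 (volume : Measure Plane) := by
  have h := aestronglyMeasurable_clm_apply (continuous_act_propagatorSymbol m t)
    (Lp.aestronglyMeasurable f)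
  exact (Lp.memLp f).of_le h
    (Eventually.of_forall fun ξ ↦ (norm_act_propagatorSymbol m t ξ (f ξ)).le)

/-- The free propagator `e^{-i t D_m}` on `L²(ℝ²; ℂ²)`, as a Fourier multiplier. -/
def propagator (m t : ℝ) (f : L2) : L2 :=
  𝓕⁻ ((memLp_propagatorSymbol m t (𝓕 f)).toLp
    (fun ξ ↦ act (propagatorSymbol m t ξ) ((𝓕 f : L2) ξ)))

/-! ### The Hartree nonlinearity -/

/-- The density `|ψ|²`, an integrable function. -/
def density (ψ : L2) (x : Plane) : ℂ := ((‖ψ x‖ ^ 2 : ℝ) : ℂ)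

/-- The Fourier transform `(b + (2π|ξ|)²)⁻¹ 𝓕(|ψ|²)(ξ)` of `(b - Δ)⁻¹ |ψ|²`. -/
def potentialFourier (b : ℝ) (ψ : L2) (ξ : Plane) : ℂ :=
  ((b + (2 * Real.pi * ‖ξ‖) ^ 2 : ℝ) : ℂ)⁻¹ * 𝓕 (density ψ) ξ

/-- The potential `(b - Δ)⁻¹ |ψ|²`, as a Fourier multiplier applied to `|ψ|² ∈ L¹`. For `ψ ∈ H^s`
with `s > 0` the inverse Fourier integral is absolutely convergent, because then
`𝓕(|ψ|²)(ξ) = O(|ξ|^{-s})`. -/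
def potential (b : ℝ) (ψ : L2) (x : Plane) : ℂ := 𝓕⁻ (potentialFourier b ψ) x

theorem continuous_potential (b : ℝ) (ψ : L2) : Continuous (potential b ψ) := by
  by_cases h : Integrable (potentialFourier b ψ)
  · exact VectorFourier.fourierIntegral_continuous Real.continuous_fourierChar
      (by exact (continuous_inner.neg : Continuous fun p : Plane × Plane ↦ -inner ℝ p.1 p.2)) h
  · have : potential b ψ = fun _ ↦ 0 := by
      ext x
      rw [potential, Real.fourierInv_eq]
      refine integral_undef fun h' ↦ h ?_
      exact (Real.fourierIntegral_convergent_iff (μ := volume) (f := potentialFourier b ψ) (-x)).1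
        (by simpa using h')
    rw [this]
    exact continuous_const

theorem norm_potential_le (b : ℝ) (ψ : L2) (x : Plane) :
    ‖potential b ψ x‖ ≤ ∫ ξ, ‖potentialFourier b ψ ξ‖ := by
  rw [potential, Real.fourierInv_eq]
  refine (norm_integral_le_integral_norm _).trans (le_of_eq ?_)
  simp

theorem memLp_nonlinearity (b : ℝ) (ψ : L2) :
    MemLp (fun x ↦ potential b ψ x • act gamma0 (ψ x)) 2 (volume : Measure Plane) := by
  have h := (act gamma0).comp_memLp' (Lp.memLp ψ)
  refine h.of_le_mul (c := ∫ ξ, ‖potentialFourier b ψ ξ‖) ?_ (Eventually.of_forall fun x ↦ ?_)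
  · exact (continuous_potential b ψ).aestronglyMeasurable.smul h.aestronglyMeasurable
  · rw [norm_smul]
    exact mul_le_mul_of_nonneg_right (norm_potential_le b ψ x) (norm_nonneg _)

/-- The nonlinear term `((b - Δ)⁻¹ |ψ|²) γ⁰ ψ`. -/
def nonlinearity (b : ℝ) (ψ : L2) : L2 :=
  (memLp_nonlinearity b ψ).toLp (fun x ↦ potential b ψ x • act gamma0 (ψ x))

/-! ### The integral equation -/

/-- The integrand `e^{-i (t - τ) D_m} ((b - Δ)⁻¹ |ψ(τ)|²) γ⁰ ψ(τ)` of the integral equation. -/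
def duhamelIntegrand (m b : ℝ) (ψ : ℝ → L2) (t τ : ℝ) : L2 :=
  propagator m (t - τ) (nonlinearity b (ψ τ))

/-- `ψ ∈ C([0, ∞); H^s)` solves, for all `t ≥ 0`, the integral equation
`ψ(t) = e^{-i t D_m} ψ₀ + i ∫₀ᵗ e^{-i (t - τ) D_m} ((b - Δ)⁻¹ |ψ(τ)|²) γ⁰ ψ(τ) dτ`. -/
def IsGlobalSolution (m b s : ℝ) (ψ₀ : L2) (ψ : ℝ → L2) : Prop :=
  ContinuousInHs s ψ ∧
    ∀ t, 0 ≤ t →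
      ψ t = propagator m t ψ₀ + Complex.I • ∫ τ in (0 : ℝ)..t, duhamelIntegrand m b ψ t τ

/-- All integrals in the integral equation for `ψ` converge absolutely. -/
def IntegralsConverge (m b : ℝ) (ψ : ℝ → L2) : Prop :=
  ∀ t, 0 ≤ t → Integrable (potentialFourier b (ψ t)) ∧
    IntervalIntegrable (duhamelIntegrand m b ψ t) volume 0 t

end DiracHartree

end

/-!
The equation is solved in the interaction picture on the Fourier side. With the weight
`⟨ξ⟩ = (1 + (2π|ξ|)²)^{1/2}`, a curve `ψ` in `H^s` is described by `g(t) = ⟨ξ⟩^s e^{i t D_m} 𝓕 ψ(t)`,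
a curve in `L²`, and the integral equation becomes an ordinary differential equation
`g' = field t g` in the Hilbert space `L²` (`continuousInHs_iff`, `duhamel_eq_iff`). The operator
`bessel`, multiplication by `⟨ξ⟩^{-s}`, recovers `𝓕 ψ` from `g`, up to the propagator.

The nonlinearity `N(ψ)` is controlled by a trilinear convolution estimate with an explicit constant,
for `0 < σ ≤ 2`:
`‖N(ψ)‖_{H^s} ≲ σ⁻¹ ‖ψ‖_{L²} ‖ψ‖_{H^σ} ‖ψ‖_{H^s}` (`l2_eweight_trimaj_le`).
It rests on the bound `1/σ` for convolution with `⟨ξ⟩⁻²` from `H^σ` to `L²`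
(`l2_conv_eweight_le`), that is, on `∫ ⟨ξ⟩^{-2-σ} dξ = O(1/σ)` in two dimensions. With a fixed `σ` the
estimate shows that `field` is Lipschitz on balls, uniformly in time (`lipschitzOnWith_field`). With
`σ` of order `1 / log(e + ‖ψ‖_{H^s})` the interpolation of `H^σ` between `L²` and `H^s` gives
`‖ψ‖_{H^σ} ≲ ‖ψ‖_{L²} + 1`, and so
`‖N(ψ)‖_{H^s} ≤ C(‖ψ‖_{L²}) log(e + ‖ψ‖_{H^s}) ‖ψ‖_{H^s}` (`norm_hartreeMap_le`).

The potential `(b - Δ)⁻¹ |ψ|²` is real and `γ⁰` is Hermitian, so `i N(ψ)` is orthogonal to `ψ` in the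
real Hilbert space `L²` and the charge `‖ψ(t)‖_{L²}` is conserved
(`re_inner_bessel_I_smul_hartreeMap`). The constant `C(‖ψ‖_{L²})` is therefore the same for all
times, and a growth of the order `x log x` excludes blow-up, as it allows at most a double
exponential (`norm_le_of_log_growth`). Global solutions then follow from the Picard-Lindelöf theorem
(`exists_global_solution`). Conversely every solution in `C([0, ∞); H^s)` comes from a solution of
the differential equation (`IsGlobalSolution.exists_eq_toPhysical`), and these are unique by
Grönwall's inequality (`eqOn_of_lipschitzOn_balls`).
-/

noncomputable section

namespace DiracHartree

/-! ### Global solvability of ordinary differential equations with logarithmic growth -/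

section ODE

open Set Metric
open scoped NNReal

/-- The radial retraction of a normed space onto the closed ball of radius `R`, for `R > 0`. -/
def radialRetraction {X : Type*} [NormedAddCommGroup X] [NormedSpace ℝ X] (R : ℝ) (x : X) : X :=
  (R / max R ‖x‖) • x

section Retraction

theorem radialRetraction_factor_le_one {X : Type*} [NormedAddCommGroup X] {R : ℝ} (hR : 0 < R)
    (x : X) : R / max R ‖x‖ ≤ 1 :=
  div_le_one_of_le₀ (le_max_left _ _) (hR.le.trans (le_max_left _ _))

theorem radialRetraction_factor_pos {X : Type*} [NormedAddCommGroup X] {R : ℝ} (hR : 0 < R)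
    (x : X) : 0 < R / max R ‖x‖ :=
  div_pos hR (hR.trans_le (le_max_left _ _))

variable {X : Type*} [NormedAddCommGroup X] [NormedSpace ℝ X] {R : ℝ}

theorem radialRetraction_of_norm_le (hR : 0 < R) {x : X} (hx : ‖x‖ ≤ R) :
    radialRetraction R x = x := by
  rw [radialRetraction, max_eq_left hx, div_self hR.ne', one_smul]

theorem norm_radialRetraction_le (hR : 0 < R) (x : X) : ‖radialRetraction R x‖ ≤ R := by
  have h := hR.trans_le (le_max_left R ‖x‖)
  rw [radialRetraction, norm_smul, Real.norm_of_nonneg (radialRetraction_factor_pos hR x).le,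
    div_mul_eq_mul_div, div_le_iff₀ h]
  exact mul_le_mul_of_nonneg_left (le_max_right _ _) hR.le

theorem norm_radialRetraction_le_norm (hR : 0 < R) (x : X) : ‖radialRetraction R x‖ ≤ ‖x‖ := by
  rw [radialRetraction, norm_smul, Real.norm_of_nonneg (radialRetraction_factor_pos hR x).le]
  exact mul_le_of_le_one_left (norm_nonneg _) (radialRetraction_factor_le_one hR x)

theorem lipschitzWith_radialRetraction (hR : 0 < R) :
    LipschitzWith 2 (radialRetraction R : X → X) := by
  refine LipschitzWith.of_dist_le_mul fun x y ↦ ?_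
  rw [dist_eq_norm, dist_eq_norm, NNReal.coe_ofNat]
  have hx := hR.trans_le (le_max_left R ‖x‖)
  have hy := hR.trans_le (le_max_left R ‖y‖)
  have h : radialRetraction R x - radialRetraction R y
      = (R / max R ‖x‖) • (x - y) + (R / max R ‖x‖ - R / max R ‖y‖) • y := by
    rw [radialRetraction, radialRetraction]; module
  have h1 : ‖(R / max R ‖x‖) • (x - y)‖ ≤ ‖x - y‖ := by
    rw [norm_smul, Real.norm_of_nonneg (radialRetraction_factor_pos hR x).le]
    exact mul_le_of_le_one_left (norm_nonneg _) (radialRetraction_factor_le_one hR x)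
  have h2 : ‖(R / max R ‖x‖ - R / max R ‖y‖) • y‖ ≤ ‖x - y‖ := by
    have e : R / max R ‖x‖ - R / max R ‖y‖
        = (R / max R ‖x‖) * ((max R ‖y‖ - max R ‖x‖) / max R ‖y‖) := by
      field_simp
    rw [norm_smul, e, norm_mul, Real.norm_of_nonneg (radialRetraction_factor_pos hR x).le,
      norm_div, Real.norm_of_nonneg hy.le, mul_assoc]
    refine (mul_le_of_le_one_left (by positivity) (radialRetraction_factor_le_one hR x)).trans ?_
    rw [div_mul_eq_mul_div, div_le_iff₀ hy]
    refine mul_le_mul ?_ (le_max_right _ _) (norm_nonneg _) (norm_nonneg _)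
    rw [Real.norm_eq_abs]
    refine (abs_max_sub_max_le_max R ‖y‖ R ‖x‖).trans ?_
    rw [sub_self, abs_zero, max_eq_right (abs_nonneg _), abs_sub_comm]
    exact abs_norm_sub_norm_le x y
  rw [h]
  linarith [norm_add_le ((R / max R ‖x‖) • (x - y)) ((R / max R ‖x‖ - R / max R ‖y‖) • y)]

end Retraction

variable {X H : Type*} [NormedAddCommGroup X] [NormedSpace ℝ X]
  [NormedAddCommGroup H] [InnerProductSpace ℂ H] [NormedSpace ℝ H]

/-- A double exponential majorizes every curve whose speed is at most `C log(e + ‖x‖) ‖x‖`. -/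
theorem norm_le_of_log_growth {g g' : ℝ → X} {C T : ℝ} (hC : 0 ≤ C)
    (hg : ∀ t ∈ Icc 0 T, HasDerivWithinAt g (g' t) (Icc 0 T) t)
    (h : ∀ t ∈ Icc 0 T, ‖g' t‖ ≤ C * (Real.log (Real.exp 1 + ‖g t‖) * ‖g t‖)) :
    ∀ t ∈ Icc 0 T, ‖g t‖ ≤
      Real.exp (Real.log (Real.exp 1 + ‖g 0‖) * Real.exp ((2 * C + 1) * t)) := by
  have he : 0 < Real.exp 1 := Real.exp_pos 1
  set κ := Real.log (Real.exp 1 + ‖g 0‖) with hκ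
  have hκ1 : 1 ≤ κ := by
    rw [hκ, Real.le_log_iff_exp_le (by positivity)]
    linarith [norm_nonneg (g 0)]
  set B : ℝ → ℝ := fun t ↦ Real.exp (κ * Real.exp ((2 * C + 1) * t)) with hB
  have hB' : ∀ t, HasDerivAt B (B t * (κ * (Real.exp ((2 * C + 1) * t) * (2 * C + 1)))) t := by
    intro t
    have := (((hasDerivAt_id t).const_mul (2 * C + 1)).exp.const_mul κ).exp
    simpa [hB] using this
  refine image_norm_le_of_norm_deriv_right_lt_deriv_boundary (f' := g')
    (fun t ht ↦ (hg t ht).continuousWithinAt)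
    (fun t ht ↦ (hg t (Ico_subset_Icc_self ht)).mono_of_mem_nhdsWithin
      (Icc_mem_nhdsGE_of_mem ht)) ?_ hB' ?_
  · simp only [mul_zero, Real.exp_zero, mul_one]
    rw [hκ, Real.exp_log (by positivity)]
    linarith
  · intro t ht hgt
    refine (h t (Ico_subset_Icc_self ht)).trans_lt ?_
    rw [hgt]
    have hE : 1 ≤ Real.exp ((2 * C + 1) * t) :=
      Real.one_le_exp (mul_nonneg (by linarith) ht.1)
    set Λ := κ * Real.exp ((2 * C + 1) * t) with hΛ
    have hΛ1 : 1 ≤ Λ := one_le_mul_of_one_le_of_one_le hκ1 hE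
    have hBt : B t = Real.exp Λ := rfl
    have hB0 : 0 < B t := by rw [hBt]; exact Real.exp_pos _
    have h2 : (2 : ℝ) ≤ Real.exp Λ := by linarith [Real.add_one_le_exp Λ]
    have hlog : Real.log (Real.exp 1 + B t) ≤ 2 * Λ := by
      rw [Real.log_le_iff_le_exp (by positivity), hBt, two_mul, Real.exp_add]
      nlinarith [Real.exp_le_exp.2 hΛ1, Real.exp_pos Λ]
    calc C * (Real.log (Real.exp 1 + B t) * B t) ≤ C * (2 * Λ * B t) := by gcongr
      _ < B t * (κ * (Real.exp ((2 * C + 1) * t) * (2 * C + 1))) := by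
        rw [← mul_assoc κ, ← hΛ]
        nlinarith [mul_pos hB0 (one_pos.trans_le hΛ1)]

/-- Along a differentiable curve, `‖J g‖` is constant when `J g'` is orthogonal to `J g`. -/
theorem norm_clm_eq_of_re_inner_eq_zero (J : X →L[ℝ] H) {g g' : ℝ → X} {T : ℝ}
    (hg : ∀ t ∈ Icc 0 T, HasDerivWithinAt g (g' t) (Icc 0 T) t)
    (h : ∀ t ∈ Icc 0 T, (inner ℂ (J (g t)) (J (g' t))).re = 0) :
    ∀ t ∈ Icc 0 T, ‖J (g t)‖ = ‖J (g 0)‖ := by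
  have hd : ∀ t ∈ Icc 0 T,
      HasDerivWithinAt (fun t ↦ inner ℂ (J (g t)) (J (g t)))
        (inner ℂ (J (g t)) (J (g' t)) + inner ℂ (J (g' t)) (J (g t))) (Icc 0 T) t := by
    intro t ht
    have h1 : HasDerivWithinAt (fun t ↦ J (g t)) (J (g' t)) (Icc 0 T) t :=
      J.hasFDerivAt.comp_hasDerivWithinAt t (hg t ht)
    exact h1.inner ℂ h1
  intro t ht
  have hc : inner ℂ (J (g t)) (J (g t)) = inner ℂ (J (g 0)) (J (g 0)) := by
    refine constant_of_has_deriv_right_zero (f := fun t ↦ inner ℂ (J (g t)) (J (g t)))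
      (fun t ht ↦ (hd t ht).continuousWithinAt) (fun t ht ↦ ?_) t ht
    have h0 : inner ℂ (J (g t)) (J (g' t)) + inner ℂ (J (g' t)) (J (g t)) = 0 := by
      rw [← inner_conj_symm (J (g' t)) (J (g t)), Complex.add_conj,
        h t (Ico_subset_Icc_self ht)]
      simp
    have := (hd t (Ico_subset_Icc_self ht)).mono_of_mem_nhdsWithin
      (Icc_mem_nhdsGE_of_mem ht)
    rwa [h0] at this
  rw [inner_self_eq_norm_sq_to_K, inner_self_eq_norm_sq_to_K] at hc
  have hc' : ‖J (g t)‖ ^ 2 = ‖J (g 0)‖ ^ 2 := by exact_mod_cast hc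
  exact (pow_left_inj₀ (norm_nonneg _) (norm_nonneg _) two_ne_zero).1 hc'

/-- A vector field `F` that is Lipschitz on balls, uniformly in time, has at most one integral curve
on `[0, T]` with given initial value. -/
theorem eqOn_of_lipschitzOn_balls {F : ℝ → X → X} {K : ℝ → ℝ≥0}
    (hLip : ∀ R t, LipschitzOnWith (K R) (F t) (closedBall 0 R)) {T : ℝ} {g₁ g₂ : ℝ → X}
    (h₁ : ∀ t ∈ Icc 0 T, HasDerivWithinAt g₁ (F t (g₁ t)) (Icc 0 T) t)
    (h₂ : ∀ t ∈ Icc 0 T, HasDerivWithinAt g₂ (F t (g₂ t)) (Icc 0 T) t)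
    (h0 : g₁ 0 = g₂ 0) : EqOn g₁ g₂ (Icc 0 T) := by
  have c₁ : ContinuousOn g₁ (Icc 0 T) := fun t ht ↦ (h₁ t ht).continuousWithinAt
  have c₂ : ContinuousOn g₂ (Icc 0 T) := fun t ht ↦ (h₂ t ht).continuousWithinAt
  obtain ⟨R₁, hR₁⟩ := isCompact_Icc.exists_bound_of_continuousOn c₁
  obtain ⟨R₂, hR₂⟩ := isCompact_Icc.exists_bound_of_continuousOn c₂
  refine ODE_solution_unique_of_mem_Icc_right (v := F) (s := fun _ ↦ closedBall 0 (max R₁ R₂))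
    (K := K (max R₁ R₂)) (fun t _ ↦ hLip _ t) c₁ ?_ ?_ c₂ ?_ ?_ h0
  · exact fun t ht ↦ (h₁ t (Ico_subset_Icc_self ht)).mono_of_mem_nhdsWithin
      (Icc_mem_nhdsGE_of_mem ht)
  · exact fun t ht ↦ mem_closedBall_zero_iff.2
      ((hR₁ t (Ico_subset_Icc_self ht)).trans (le_max_left _ _))
  · exact fun t ht ↦ (h₂ t (Ico_subset_Icc_self ht)).mono_of_mem_nhdsWithin
      (Icc_mem_nhdsGE_of_mem ht)
  · exact fun t ht ↦ mem_closedBall_zero_iff.2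
      ((hR₂ t (Ico_subset_Icc_self ht)).trans (le_max_right _ _))

/-- Solvability on `[0, T]`. The field is truncated outside a ball; conservation of `‖J x‖` and the
logarithmic growth survive the truncation, so the truncated solution obeys a bound that does not
depend on the radius of the ball and, for a large radius, it does not see the truncation. -/
theorem exists_solution_Icc [CompleteSpace X] [IsScalarTower ℝ ℂ H] (J : X →L[ℝ] H)
    {F : ℝ → X → X} {K : ℝ → ℝ≥0}
    (hcont : ∀ x, Continuous fun t ↦ F t x)
    (hLip : ∀ R t, LipschitzOnWith (K R) (F t) (closedBall 0 R))
    (hgrow : ∀ M, ∃ C, 0 ≤ C ∧ ∀ t x, ‖J x‖ ≤ M →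
      ‖F t x‖ ≤ C * (Real.log (Real.exp 1 + ‖x‖) * ‖x‖))
    (hcons : ∀ t x, (inner ℂ (J x) (J (F t x))).re = 0) (x₀ : X) {T : ℝ} (hT : 0 ≤ T) :
    ∃ g : ℝ → X, g 0 = x₀ ∧ (∀ t ∈ Icc 0 T, HasDerivWithinAt g (F t (g t)) (Icc 0 T) t) ∧
      ∀ t ∈ Icc 0 T, ‖J (g t)‖ = ‖J x₀‖ := by
  obtain ⟨C, hC, hgrow⟩ := hgrow ‖J x₀‖
  set B : ℝ → ℝ := fun t ↦
    Real.exp (Real.log (Real.exp 1 + ‖x₀‖) * Real.exp ((2 * C + 1) * t)) with hB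
  set R := B T with hRdef
  have hR : 0 < R := Real.exp_pos _
  set G : ℝ → X → X := fun t x ↦ F t (radialRetraction R x) with hG
  have hmem : ∀ x : X, radialRetraction R x ∈ closedBall (0 : X) R := fun x ↦
    mem_closedBall_zero_iff.2 (norm_radialRetraction_le hR x)
  have hGLip : ∀ t, LipschitzWith (K R * 2) (G t) := by
    intro t
    have := (hLip R t).comp (lipschitzWith_radialRetraction (X := X) hR).lipschitzOnWith
      (s := univ) (fun x _ ↦ hmem x)
    exact lipschitzOnWith_univ.1 this
  -- the truncated field is bounded on `[0, T]`
  obtain ⟨L₀, hL₀⟩ := isCompact_Icc.exists_bound_of_continuousOn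
    (hcont 0).continuousOn (s := Icc (0 : ℝ) T)
  have hL : ∀ t ∈ Icc 0 T, ∀ x, ‖G t x‖ ≤ K R * R + L₀ := by
    intro t ht x
    have h1 := (hLip R t).norm_sub_le (hmem x) (mem_closedBall_self hR.le)
    rw [sub_zero] at h1
    have h2 : (K R : ℝ) * ‖radialRetraction R x‖ ≤ K R * R :=
      mul_le_mul_of_nonneg_left (norm_radialRetraction_le hR x) (K R).2
    calc ‖G t x‖ = ‖(F t (radialRetraction R x) - F t 0) + F t 0‖ := by rw [sub_add_cancel]
      _ ≤ _ := (norm_add_le _ _).trans (add_le_add (h1.trans h2) (hL₀ t ht))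
  have hLnn : 0 ≤ K R * R + L₀ := (norm_nonneg _).trans (hL 0 ⟨le_rfl, hT⟩ 0)
  have hPL : IsPicardLindelof G (⟨0, le_rfl, hT⟩ : Icc 0 T) x₀
      (⟨(K R * R + L₀) * T, by positivity⟩) 0 ⟨K R * R + L₀, hLnn⟩ (K R * 2) := by
    refine ⟨fun t _ ↦ (hGLip t).lipschitzOnWith, fun x _ ↦ (hcont _).continuousOn,
      fun t ht x _ ↦ hL t ht x, ?_⟩
    simp only [sub_zero, sub_self, max_eq_left hT, NNReal.coe_zero]
    exact le_rfl
  obtain ⟨g, hg0, hg⟩ := hPL.exists_eq_forall_mem_Icc_hasDerivWithinAt₀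
  simp only at hg0
  have hcons' : ∀ t ∈ Icc 0 T, ‖J (g t)‖ = ‖J (g 0)‖ := by
    refine norm_clm_eq_of_re_inner_eq_zero J hg fun t _ ↦ ?_
    have h1 := hcons t (radialRetraction R (g t))
    have h2 : J (radialRetraction R (g t)) =
        (((R / max R ‖g t‖ : ℝ) : ℂ)) • J (g t) := by
      rw [radialRetraction, map_smul]
      exact RCLike.real_smul_eq_coe_smul (K := ℂ) _ _
    rw [h2, inner_smul_left, Complex.conj_ofReal, Complex.re_ofReal_mul] at h1
    exact (mul_eq_zero.1 h1).resolve_left (radialRetraction_factor_pos hR _).ne'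
  have hbound : ∀ t ∈ Icc 0 T, ‖g t‖ ≤ R := by
    intro t ht
    have h1 := norm_le_of_log_growth hC hg (fun t ht ↦ ?_) t ht
    · rw [hg0] at h1
      refine h1.trans ?_
      simp only [hRdef, hB]
      have : 0 ≤ Real.log (Real.exp 1 + ‖x₀‖) := Real.log_nonneg
        (by linarith [Real.add_one_le_exp (1 : ℝ), norm_nonneg x₀])
      have := ht.2
      gcongr
    · have hJ : ‖J (radialRetraction R (g t))‖ ≤ ‖J x₀‖ := by
        rw [← hg0, ← hcons' t ht, radialRetraction, map_smul, norm_smul,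
          Real.norm_of_nonneg (radialRetraction_factor_pos hR _).le]
        exact mul_le_of_le_one_left (norm_nonneg _) (radialRetraction_factor_le_one hR _)
      refine (hgrow t _ hJ).trans ?_
      have h2 := norm_radialRetraction_le_norm hR (g t)
      have h3 : 0 ≤ Real.log (Real.exp 1 + ‖g t‖) := Real.log_nonneg
        (by linarith [Real.add_one_le_exp (1 : ℝ), norm_nonneg (g t)])
      have h4 : Real.log (Real.exp 1 + ‖radialRetraction R (g t)‖)
          ≤ Real.log (Real.exp 1 + ‖g t‖) :=
        Real.log_le_log (by positivity) (by linarith)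
      gcongr
  refine ⟨g, hg0, fun t ht ↦ ?_, fun t ht ↦ by rw [hcons' t ht, hg0]⟩
  have := hg t ht
  simp only [hG] at this
  rwa [radialRetraction_of_norm_le hR (hbound t ht)] at this

/-- Global solvability: the solutions on the intervals `[0, T]` agree where they are both defined.
The value of the global solution at the time `t` is taken from the solution on `[0, t]`. -/
theorem exists_global_solution [CompleteSpace X] [IsScalarTower ℝ ℂ H] (J : X →L[ℝ] H)
    {F : ℝ → X → X} {K : ℝ → ℝ≥0}
    (hcont : ∀ x, Continuous fun t ↦ F t x)
    (hLip : ∀ R t, LipschitzOnWith (K R) (F t) (closedBall 0 R))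
    (hgrow : ∀ M, ∃ C, 0 ≤ C ∧ ∀ t x, ‖J x‖ ≤ M →
      ‖F t x‖ ≤ C * (Real.log (Real.exp 1 + ‖x‖) * ‖x‖))
    (hcons : ∀ t x, (inner ℂ (J x) (J (F t x))).re = 0) (x₀ : X) :
    ∃ g : ℝ → X, g 0 = x₀ ∧ (∀ T, ∀ t ∈ Icc 0 T, HasDerivWithinAt g (F t (g t)) (Icc 0 T) t) ∧
      ∀ t, 0 ≤ t → ‖J (g t)‖ = ‖J x₀‖ := by
  choose! u hu0 hu huJ using fun T : ℝ ↦ fun hT : 0 ≤ T ↦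
    exists_solution_Icc J hcont hLip hgrow hcons x₀ hT
  have huniq : ∀ S T, 0 ≤ S → S ≤ T → EqOn (u S) (u T) (Icc 0 S) := by
    intro S T hS hST
    have hsub : Icc 0 S ⊆ Icc 0 T := Icc_subset_Icc_right hST
    exact eqOn_of_lipschitzOn_balls hLip (hu S hS)
      (fun t ht ↦ (hu T (hS.trans hST) t (hsub ht)).mono hsub)
      ((hu0 S hS).trans (hu0 T (hS.trans hST)).symm)
  refine ⟨fun t ↦ u t t, hu0 0 le_rfl, fun T t ht ↦ ?_, fun t ht ↦ huJ t ht t ⟨ht, le_rfl⟩⟩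
  have hT : 0 ≤ T := ht.1.trans ht.2
  have heq : ∀ r ∈ Icc 0 T, u r r = u T r := fun r hr ↦
    huniq r T hr.1 hr.2 ⟨hr.1, le_rfl⟩
  have := (hu T hT t ht).congr (f₁ := fun t ↦ u t t) heq (heq t ht)
  simpa only [← heq t ht] using this

end ODE

/-! ### Sobolev weights -/

/-- The Sobolev weight `(1 + (2π|ξ|)²)^{s/2}`. -/
def weight (s : ℝ) (ξ : Plane) : ℝ := (1 + (2 * Real.pi * ‖ξ‖) ^ 2) ^ (s / 2)

theorem weight_pos (s : ℝ) (ξ : Plane) : 0 < weight s ξ := by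
  unfold weight; positivity

theorem continuous_weight (s : ℝ) : Continuous (weight s) :=
  Continuous.rpow_const (by fun_prop) fun x ↦ Or.inl (by positivity)

theorem weight_add (s r : ℝ) (ξ : Plane) : weight (s + r) ξ = weight s ξ * weight r ξ := by
  rw [weight, weight, weight, ← Real.rpow_add (by positivity), add_div]

theorem weight_zero (ξ : Plane) : weight 0 ξ = 1 := by simp [weight]

theorem weight_neg_mul_self (s : ℝ) (ξ : Plane) : weight (-s) ξ * weight s ξ = 1 := by
  rw [← weight_add, neg_add_cancel, weight_zero]

theorem weight_even (s : ℝ) (ξ : Plane) : weight s (-ξ) = weight s ξ := by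
  simp [weight]

theorem weight_mono {s r : ℝ} (h : s ≤ r) (ξ : Plane) : weight s ξ ≤ weight r ξ :=
  Real.rpow_le_rpow_of_exponent_le (by nlinarith [sq_nonneg (2 * Real.pi * ‖ξ‖)]) (by linarith)

theorem weight_two (ξ : Plane) : weight 2 ξ = 1 + (2 * Real.pi * ‖ξ‖) ^ 2 := by
  simp [weight]

/-- Peetre's inequality in its quasi-subadditive form. -/
theorem weight_add_add_le {s : ℝ} (hs : 0 ≤ s) (x y z : Plane) :
    weight s (x + y + z) ≤ 9 ^ (s / 2) * (weight s x + weight s y + weight s z) := by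
  have key : ∀ p : Plane, ‖x‖ ≤ ‖p‖ → ‖y‖ ≤ ‖p‖ → ‖z‖ ≤ ‖p‖ →
      weight s (x + y + z) ≤ 9 ^ (s / 2) * weight s p := by
    intro p hx hy hz
    rw [weight, weight, ← Real.mul_rpow (by norm_num) (by positivity)]
    refine Real.rpow_le_rpow (by positivity) ?_ (by positivity)
    have h1 : ‖x + y + z‖ ≤ 3 * ‖p‖ := by linarith [norm_add₃_le (a := x) (b := y) (c := z)]
    have h2 : (2 * Real.pi * ‖x + y + z‖) ^ 2 ≤ (2 * Real.pi * (3 * ‖p‖)) ^ 2 := by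
      gcongr
    nlinarith
  have h9 : (0 : ℝ) < 9 ^ (s / 2) := by positivity
  have px := weight_pos s x
  have py := weight_pos s y
  have pz := weight_pos s z
  rcases le_total ‖x‖ ‖y‖ with hxy | hxy <;> rcases le_total ‖y‖ ‖z‖ with hyz | hyz <;>
    rcases le_total ‖x‖ ‖z‖ with hxz | hxz
  · refine (key z hxz hyz le_rfl).trans (mul_le_mul_of_nonneg_left (by linarith) h9.le)
  · refine (key x le_rfl (hyz.trans hxz) hxz).trans
      (mul_le_mul_of_nonneg_left (by linarith) h9.le)
  · refine (key y hxy le_rfl hyz).trans (mul_le_mul_of_nonneg_left (by linarith) h9.le)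
  · refine (key y hxy le_rfl hyz).trans (mul_le_mul_of_nonneg_left (by linarith) h9.le)
  · refine (key z hxz hyz le_rfl).trans (mul_le_mul_of_nonneg_left (by linarith) h9.le)
  · refine (key x le_rfl hxy hxz).trans (mul_le_mul_of_nonneg_left (by linarith) h9.le)
  · refine (key x le_rfl hxy (hyz.trans hxy)).trans
      (mul_le_mul_of_nonneg_left (by linarith) h9.le)
  · refine (key x le_rfl hxy hxz).trans (mul_le_mul_of_nonneg_left (by linarith) h9.le)

/-- The pointwise inequality behind the logarithmic interpolation of `H^σ` between `L²` and
`H^s`. -/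
theorem weight_le_interpolation {s σ A : ℝ} (hs : 0 < s) (hσs : σ ≤ s)
    (hσ : 0 ≤ σ) (hA : 0 < A) (ξ : Plane) :
    weight σ ξ ≤ A ^ (σ / s) * (1 + A⁻¹ * weight s ξ) := by
  have hy := weight_pos s ξ
  have e : weight σ ξ = weight s ξ ^ (σ / s) := by
    rw [weight, weight, ← Real.rpow_mul (by positivity)]
    congr 1
    field_simp
  rw [e]
  have hq : 0 < A ^ (σ / s) := by positivity
  rcases le_total (weight s ξ) A with h | h
  · refine (Real.rpow_le_rpow hy.le h (by positivity)).trans ?_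
    exact le_mul_of_one_le_right hq.le (by have := mul_pos (inv_pos.2 hA) hy; linarith)
  · have h1 : weight s ξ ^ (σ / s) = weight s ξ * weight s ξ ^ (σ / s - 1) := by
      rw [Real.rpow_sub_one hy.ne']; field_simp
    have h2 : weight s ξ ^ (σ / s - 1) ≤ A ^ (σ / s - 1) :=
      Real.rpow_le_rpow_of_nonpos hA h (by rw [sub_nonpos]; exact (div_le_one hs).2 hσs)
    rw [h1]
    refine (mul_le_mul_of_nonneg_left h2 hy.le).trans ?_
    rw [Real.rpow_sub_one hA.ne', mul_add, mul_one]
    have : weight s ξ * (A ^ (σ / s) / A) = A ^ (σ / s) * (A⁻¹ * weight s ξ) := by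
      field_simp
    linarith

/-- The value of `∫ (1 + (2π|ξ|)²)^{-1-σ/2} dξ`; what matters is that it is `O(1/σ)`. -/
theorem lintegral_weight {σ : ℝ} (hσ : 0 < σ) :
    ∫⁻ ξ : Plane, ENNReal.ofReal (weight (-(2 + σ)) ξ) = ENNReal.ofReal (1 / (2 * Real.pi * σ)) := by
  set f : ℝ → ℝ := fun y ↦ (1 + (2 * Real.pi * y) ^ 2) ^ (-(2 + σ) / 2) with hf
  set Φ : ℝ → ℝ := fun y ↦ -(1 + (2 * Real.pi * y) ^ 2) ^ (-(σ / 2)) / (4 * Real.pi ^ 2 * σ) with hΦ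
  have hpi := Real.pi_pos
  have hder : ∀ y ∈ Set.Ioi (0 : ℝ), HasDerivAt Φ (y ^ (2 - 1) • f y) y := by
    intro y _
    have h0 : (0 : ℝ) < 1 + (2 * Real.pi * y) ^ 2 := by positivity
    have h1 : HasDerivAt (fun y : ℝ ↦ 1 + (2 * Real.pi * y) ^ 2)
        (2 * (2 * Real.pi * y) * (2 * Real.pi)) y := by
      have := (((hasDerivAt_id y).const_mul (2 * Real.pi)).pow 2).const_add 1
      simpa using this
    have h2 := ((h1.rpow_const (p := -(σ / 2)) (Or.inl h0.ne')).neg).div_const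
      (4 * Real.pi ^ 2 * σ)
    refine h2.congr_deriv ?_
    have e : -(σ / 2) - 1 = -(2 + σ) / 2 := by ring
    rw [e]
    simp only [hf, smul_eq_mul, Nat.reduceSub, pow_one]
    field_simp
    ring
  have hcont : ContinuousWithinAt Φ (Set.Ici 0) 0 := by
    have : Continuous Φ := by
      refine Continuous.div_const (Continuous.neg ?_) _
      exact Continuous.rpow_const (by fun_prop) fun x ↦ Or.inl (by positivity)
    exact this.continuousWithinAt
  have hlim : Tendsto Φ atTop (𝓝 0) := by
    have h1 : Tendsto (fun y : ℝ ↦ 1 + (2 * Real.pi * y) ^ 2) atTop atTop := by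
      refine tendsto_atTop_add_const_left _ _ ?_
      exact (tendsto_pow_atTop two_ne_zero).comp (tendsto_id.const_mul_atTop (by positivity))
    have h2 := ((tendsto_rpow_neg_atTop (y := σ / 2) (by positivity)).comp h1).neg.div_const
      (4 * Real.pi ^ 2 * σ)
    simpa [hΦ] using h2
  have hnn : ∀ y ∈ Set.Ioi (0 : ℝ), 0 ≤ y ^ (2 - 1) • f y := by
    intro y hy
    have : (0 : ℝ) < y := hy
    simp only [hf, smul_eq_mul]
    positivity
  have hint := integrableOn_Ioi_deriv_of_nonneg hcont hder hnn hlim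
  have hval := integral_Ioi_of_hasDerivAt_of_nonneg hcont hder hnn hlim
  have hdim : Module.finrank ℝ Plane = 2 := by simp
  have hI : Integrable (fun ξ : Plane ↦ f ‖ξ‖) volume := by
    rw [integrable_fun_norm_addHaar (μ := volume) (E := Plane) (f := f), hdim]
    exact hint
  have hw : ∀ ξ : Plane, weight (-(2 + σ)) ξ = f ‖ξ‖ := fun ξ ↦ rfl
  simp_rw [hw]
  rw [← ofReal_integral_eq_lintegral_ofReal hI
    (Eventually.of_forall fun ξ ↦ (weight_pos (-(2 + σ)) ξ).le),
    integral_fun_norm_addHaar (μ := volume) (E := Plane) f, hdim, hval]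
  congr 1
  have hvol : (volume : Measure Plane).real (Metric.ball 0 1) = Real.pi := by
    rw [Measure.real, EuclideanSpace.volume_ball_fin_two]
    simp [Real.pi_nonneg]
  rw [hvol]
  simp only [hΦ, nsmul_eq_mul, smul_eq_mul]
  field_simp
  norm_num

/-! ### Trilinear estimates for the Fourier transform of the nonlinearity -/

/-- The Sobolev weight `(1 + (2π|ξ|)²)^{s/2}` as an extended nonnegative number. -/
def eweight (s : ℝ) (ξ : Plane) : ℝ≥0∞ := ENNReal.ofReal (weight s ξ)

@[fun_prop]
theorem measurable_eweight (s : ℝ) : Measurable (eweight s) :=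
  ENNReal.measurable_ofReal.comp (continuous_weight s).measurable

theorem eweight_add (s r : ℝ) (ξ : Plane) : eweight (s + r) ξ = eweight s ξ * eweight r ξ := by
  rw [eweight, weight_add, ENNReal.ofReal_mul (weight_pos s ξ).le]; rfl

theorem eweight_zero (ξ : Plane) : eweight 0 ξ = 1 := by simp [eweight, weight_zero]

theorem eweight_neg_mul_self (s : ℝ) (ξ : Plane) : eweight (-s) ξ * eweight s ξ = 1 := by
  rw [← eweight_add, neg_add_cancel, eweight_zero]

theorem eweight_mono {s r : ℝ} (h : s ≤ r) (ξ : Plane) : eweight s ξ ≤ eweight r ξ :=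
  ENNReal.ofReal_le_ofReal (weight_mono h ξ)

/-- The `L²` norm of a function with values in `[0, ∞]`. -/
def l2 (a : Plane → ℝ≥0∞) : ℝ≥0∞ := (∫⁻ ξ, a ξ ^ (2 : ℝ)) ^ (1 / 2 : ℝ)

theorem l2_sq (a : Plane → ℝ≥0∞) : l2 a ^ (2 : ℝ) = ∫⁻ ξ, a ξ ^ (2 : ℝ) := by
  rw [l2, ← ENNReal.rpow_mul]; norm_num

theorem l2_mono {a b : Plane → ℝ≥0∞} (h : ∀ᵐ ξ, a ξ ≤ b ξ) : l2 a ≤ l2 b := by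
  refine ENNReal.rpow_le_rpow (lintegral_mono_ae ?_) (by norm_num)
  filter_upwards [h] with ξ hξ
  exact ENNReal.rpow_le_rpow hξ (by norm_num)

theorem l2_const_mul (c : ℝ≥0∞) {a : Plane → ℝ≥0∞} (ha : Measurable a) :
    l2 (fun ξ ↦ c * a ξ) = c * l2 a := by
  simp_rw [l2, ENNReal.mul_rpow_of_nonneg _ _ (show (0 : ℝ) ≤ 2 by norm_num)]
  rw [lintegral_const_mul _ (by fun_prop), ENNReal.mul_rpow_of_nonneg _ _ (by norm_num),
    ← ENNReal.rpow_mul]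
  norm_num

theorem l2_add_le {a b : Plane → ℝ≥0∞} (ha : Measurable a) (hb : Measurable b) :
    l2 (fun ξ ↦ a ξ + b ξ) ≤ l2 a + l2 b :=
  ENNReal.lintegral_Lp_add_le ha.aemeasurable hb.aemeasurable one_le_two

theorem lintegral_mul_le_l2 {a b : Plane → ℝ≥0∞} (ha : Measurable a) (hb : Measurable b) :
    ∫⁻ ξ, a ξ * b ξ ≤ l2 a * l2 b :=
  ENNReal.lintegral_mul_le_Lp_mul_Lq volume Real.HolderConjugate.two_two
    ha.aemeasurable hb.aemeasurable

theorem l2_translate (a : Plane → ℝ≥0∞) (ζ : Plane) : l2 (fun ξ ↦ a (ξ + ζ)) = l2 a := by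
  rw [l2, lintegral_add_right_eq_self (fun ξ ↦ a ξ ^ (2 : ℝ)) ζ, l2]

theorem eLpNorm_two_eq_l2 {F : Type*} [NormedAddCommGroup F] (f : Plane → F) :
    eLpNorm f 2 volume = l2 fun ξ ↦ ‖f ξ‖ₑ := by
  rw [eLpNorm_eq_lintegral_rpow_enorm_toReal two_ne_zero ENNReal.ofNat_ne_top]
  simp [l2]

/-- The convolution of two functions with values in `[0, ∞]`. -/
def conv (p q : Plane → ℝ≥0∞) (ξ : Plane) : ℝ≥0∞ := ∫⁻ ζ, p ζ * q (ξ - ζ)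

@[fun_prop]
theorem measurable_conv {p q : Plane → ℝ≥0∞} (hp : Measurable p) (hq : Measurable q) :
    Measurable (conv p q) := by
  refine Measurable.lintegral_prod_right' (f := fun z : Plane × Plane ↦ p z.2 * q (z.1 - z.2)) ?_
  fun_prop

theorem conv_comm (p q : Plane → ℝ≥0∞) : conv p q = conv q p := by
  ext ξ
  rw [conv, conv, ← lintegral_sub_left_eq_self _ ξ]
  simp [mul_comm]

/-- Young's inequality `L¹ * L² ⊆ L²`. -/
theorem l2_conv_le {p q : Plane → ℝ≥0∞} (hp : Measurable p) (hq : Measurable q) :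
    l2 (conv p q) ≤ (∫⁻ ζ, p ζ) * l2 q := by
  have h1 : ∀ ξ, conv p q ξ ^ (2 : ℝ) ≤ (∫⁻ ζ, p ζ) * conv p (fun ζ ↦ q ζ ^ (2 : ℝ)) ξ := by
    intro ξ
    have e : conv p q ξ = ∫⁻ ζ, (p ζ ^ (1 / 2 : ℝ)) * (p ζ ^ (1 / 2 : ℝ) * q (ξ - ζ)) := by
      refine lintegral_congr fun ζ ↦ ?_
      rw [← mul_assoc, ← ENNReal.rpow_add_of_nonneg _ _ (by norm_num) (by norm_num)]
      norm_num
    have hle := lintegral_mul_le_l2 (a := fun ζ ↦ p ζ ^ (1 / 2 : ℝ))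
      (b := fun ζ ↦ p ζ ^ (1 / 2 : ℝ) * q (ξ - ζ)) (by fun_prop) (by fun_prop)
    rw [← e] at hle
    refine (ENNReal.rpow_le_rpow hle (by norm_num : (0 : ℝ) ≤ 2)).trans (le_of_eq ?_)
    rw [ENNReal.mul_rpow_of_nonneg _ _ (by norm_num), l2_sq, l2_sq, conv]
    congr 1
    · refine lintegral_congr fun ζ ↦ ?_
      rw [← ENNReal.rpow_mul]; norm_num
    · refine lintegral_congr fun ζ ↦ ?_
      rw [ENNReal.mul_rpow_of_nonneg _ _ (by norm_num), ← ENNReal.rpow_mul]; norm_num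
  have h2 : ∫⁻ ξ, conv p (fun ζ ↦ q ζ ^ (2 : ℝ)) ξ = (∫⁻ ζ, p ζ) * ∫⁻ ζ, q ζ ^ (2 : ℝ) := by
    simp_rw [conv]
    rw [lintegral_lintegral_swap]
    · have : ∀ ζ, ∫⁻ ξ, p ζ * q (ξ - ζ) ^ (2 : ℝ) = p ζ * ∫⁻ ξ, q ξ ^ (2 : ℝ) := fun ζ ↦ by
        rw [lintegral_const_mul _ (by fun_prop),
          lintegral_sub_right_eq_self (fun ξ ↦ q ξ ^ (2 : ℝ)) ζ]
      simp_rw [this]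
      rw [lintegral_mul_const _ hp]
    · fun_prop
  calc l2 (conv p q) ≤ ((∫⁻ ζ, p ζ) * ((∫⁻ ζ, p ζ) * ∫⁻ ζ, q ζ ^ (2 : ℝ))) ^ (1 / 2 : ℝ) := by
        refine ENNReal.rpow_le_rpow ?_ (by norm_num)
        rw [← h2, ← lintegral_const_mul _ (by fun_prop)]
        exact lintegral_mono h1
    _ = (∫⁻ ζ, p ζ) * l2 q := by
        rw [← mul_assoc, ENNReal.mul_rpow_of_nonneg _ _ (by norm_num),
          ENNReal.mul_rpow_of_nonneg _ _ (by norm_num),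
          ← ENNReal.rpow_add_of_nonneg _ _ (by norm_num) (by norm_num), l2]
        norm_num

/-- Convolution with `⟨ξ⟩⁻²`, the majorant of the symbol of `(b - Δ)⁻¹`, maps `H^σ` to `L²` (on the
Fourier side). Where `⟨ζ⟩ ≤ ⟨ξ - ζ⟩` the weight of `H^σ` makes the kernel integrable, elsewhere it
is dominated by the product of two functions in `L²`. -/
theorem l2_conv_eweight_le {σ : ℝ} (hσ : 0 < σ) (hσ2 : σ ≤ 2) {a : Plane → ℝ≥0∞}
    (ha : Measurable a) :
    l2 (conv (eweight (-2)) a)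
      ≤ ENNReal.ofReal (1 / σ) * l2 (fun ξ ↦ eweight σ ξ * a ξ) := by
  set c : Plane → ℝ≥0∞ := fun ξ ↦ eweight σ ξ * a ξ with hc
  have hcm : Measurable c := by fun_prop
  have hac : ∀ ξ, a ξ = eweight (-σ) ξ * c ξ := fun ξ ↦ by
    rw [hc, ← mul_assoc, eweight_neg_mul_self, one_mul]
  clear_value c
  set I := ∫⁻ ξ, eweight (-(2 + σ)) ξ with hI
  have hIval : I = ENNReal.ofReal (1 / (2 * Real.pi * σ)) := lintegral_weight hσ
  set p : Plane → ℝ≥0∞ := eweight (-(1 + σ / 2)) with hp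
  have hpm : Measurable p := measurable_eweight _
  have hpp : ∫⁻ ξ, p ξ ^ (2 : ℝ) = I := by
    refine lintegral_congr fun ξ ↦ ?_
    rw [ENNReal.rpow_two, sq, hp, ← eweight_add]
    congr 1; ring
  have hker : ∀ ζ η, eweight (-2) ζ * eweight (-σ) η ≤ eweight (-(2 + σ)) ζ + p ζ * p η := by
    intro ζ η
    rcases le_total ‖ζ‖ ‖η‖ with h | h
    · refine le_add_right ?_
      rw [neg_add, eweight_add]
      gcongr
      refine ENNReal.ofReal_le_ofReal ?_
      exact Real.rpow_le_rpow_of_nonpos (by positivity) (by gcongr) (by linarith)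
    · refine le_add_left ?_
      have e1 : eweight (-2) ζ = p ζ * eweight (-(1 - σ / 2)) ζ := by
        rw [hp, ← eweight_add]; congr 1; ring
      have e2 : p η = eweight (-(1 - σ / 2)) η * eweight (-σ) η := by
        rw [hp, ← eweight_add]; congr 1; ring
      rw [e1, e2, mul_assoc]
      gcongr
      refine ENNReal.ofReal_le_ofReal ?_
      exact Real.rpow_le_rpow_of_nonpos (by positivity) (by gcongr) (by linarith)
  have hpt : ∀ ξ, conv (eweight (-2)) a ξ
      ≤ conv (eweight (-(2 + σ))) c ξ + conv p (fun η ↦ p η * c η) ξ := by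
    intro ξ
    rw [conv, conv, conv, ← lintegral_add_left (by fun_prop)]
    refine lintegral_mono fun ζ ↦ ?_
    rw [hac (ξ - ζ), ← mul_assoc, ← mul_assoc, ← add_mul]
    gcongr
    exact hker _ _
  have hl2p : l2 p * l2 p = I := by
    rw [l2, hpp, ← ENNReal.rpow_add_of_nonneg _ _ (by norm_num) (by norm_num)]
    norm_num
  have hfin : I + I ≤ ENNReal.ofReal (1 / σ) := by
    rw [hIval, ← ENNReal.ofReal_add (by positivity) (by positivity)]
    refine ENNReal.ofReal_le_ofReal ?_
    have hpi := Real.pi_gt_three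
    have : 1 / (2 * Real.pi * σ) + 1 / (2 * Real.pi * σ) = 1 / Real.pi * (1 / σ) := by
      field_simp; norm_num
    rw [this]
    refine mul_le_of_le_one_left (by positivity) ?_
    rw [div_le_one (by positivity)]; linarith
  calc l2 (conv (eweight (-2)) a)
      ≤ l2 (conv (eweight (-(2 + σ))) c) + l2 (conv p (fun η ↦ p η * c η)) :=
        (l2_mono (Eventually.of_forall hpt)).trans (l2_add_le (by fun_prop) (by fun_prop))
    _ ≤ I * l2 c + (l2 p * l2 c) * l2 p := by
        refine add_le_add (l2_conv_le (by fun_prop) hcm) ?_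
        rw [conv_comm]
        refine (l2_conv_le (by fun_prop) hpm).trans ?_
        gcongr
        exact lintegral_mul_le_l2 hpm hcm
    _ = (I + I) * l2 c := by rw [mul_right_comm, hl2p, add_mul]
    _ ≤ _ := by gcongr

/-- The correlation `∫ a(η) b(η + ζ) dη`, which dominates the Fourier transform of a density. -/
def corr (a b : Plane → ℝ≥0∞) (ζ : Plane) : ℝ≥0∞ := ∫⁻ η, a η * b (η + ζ)

/-- The trilinear majorant of the Fourier transform of the nonlinearity. -/
def trimaj (a b c : Plane → ℝ≥0∞) : Plane → ℝ≥0∞ :=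
  conv (fun ζ ↦ eweight (-2) ζ * corr a b ζ) c

@[fun_prop]
theorem measurable_corr {a b : Plane → ℝ≥0∞} (ha : Measurable a) (hb : Measurable b) :
    Measurable (corr a b) := by
  refine Measurable.lintegral_prod_right' (f := fun z : Plane × Plane ↦ a z.2 * b (z.2 + z.1)) ?_
  fun_prop

@[fun_prop]
theorem measurable_trimaj {a b c : Plane → ℝ≥0∞} (ha : Measurable a) (hb : Measurable b)
    (hc : Measurable c) : Measurable (trimaj a b c) := by
  unfold trimaj; fun_prop

theorem corr_le {a b : Plane → ℝ≥0∞} (ha : Measurable a) (hb : Measurable b) (ζ : Plane) :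
    corr a b ζ ≤ l2 a * l2 b := by
  rw [← l2_translate b ζ]
  exact lintegral_mul_le_l2 ha (by fun_prop)

/-- The symbol of `(b - Δ)⁻¹` times the Fourier transform of a density is integrable, as soon as one
of the two factors of the density is in `H^σ`. -/
theorem lintegral_eweight_mul_corr_le {σ : ℝ} (hσ : 0 < σ) (hσ2 : σ ≤ 2) {a b : Plane → ℝ≥0∞}
    (ha : Measurable a) (hb : Measurable b) :
    ∫⁻ ζ, eweight (-2) ζ * corr a b ζ
      ≤ ENNReal.ofReal (1 / σ) * l2 (fun ξ ↦ eweight σ ξ * a ξ) * l2 b := by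
  have h1 : ∀ ζ, eweight (-2) ζ * corr a b ζ = ∫⁻ ξ, b ξ * (eweight (-2) ζ * a (ξ - ζ)) := by
    intro ζ
    rw [corr, ← lintegral_const_mul _ (by fun_prop), ← lintegral_sub_right_eq_self _ ζ]
    refine lintegral_congr fun ξ ↦ ?_
    rw [sub_add_cancel]; ring
  simp_rw [h1]
  rw [lintegral_lintegral_swap (by fun_prop)]
  have h2 : ∀ ξ, ∫⁻ ζ, b ξ * (eweight (-2) ζ * a (ξ - ζ)) = b ξ * conv (eweight (-2)) a ξ :=
    fun ξ ↦ lintegral_const_mul _ (by fun_prop)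
  simp_rw [h2]
  refine (lintegral_mul_le_l2 hb (by fun_prop)).trans ?_
  rw [mul_comm]
  gcongr
  exact l2_conv_eweight_le hσ hσ2 ha

theorem l2_trimaj_le_first {σ : ℝ} (hσ : 0 < σ) (hσ2 : σ ≤ 2) {a b c : Plane → ℝ≥0∞}
    (ha : Measurable a) (hb : Measurable b) (hc : Measurable c) :
    l2 (trimaj a b c)
      ≤ ENNReal.ofReal (1 / σ) * (l2 (fun ξ ↦ eweight σ ξ * a ξ) * l2 b * l2 c) := by
  refine (l2_conv_le (by fun_prop) hc).trans ?_
  refine (mul_le_mul_left (lintegral_eweight_mul_corr_le hσ hσ2 ha hb) _).trans (le_of_eq ?_)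
  ring

theorem l2_trimaj_le_third {σ : ℝ} (hσ : 0 < σ) (hσ2 : σ ≤ 2) {a b c : Plane → ℝ≥0∞}
    (ha : Measurable a) (hb : Measurable b) (hc : Measurable c) :
    l2 (trimaj a b c)
      ≤ ENNReal.ofReal (1 / σ) * (l2 a * l2 b * l2 (fun ξ ↦ eweight σ ξ * c ξ)) := by
  have h : ∀ ξ, trimaj a b c ξ ≤ (l2 a * l2 b) * conv (eweight (-2)) c ξ := by
    intro ξ
    rw [trimaj, conv, conv, ← lintegral_const_mul _ (by fun_prop)]
    refine lintegral_mono fun ζ ↦ ?_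
    rw [mul_comm (eweight (-2) ζ), mul_assoc]
    exact mul_le_mul_left (corr_le ha hb ζ) _
  refine (l2_mono (Eventually.of_forall h)).trans ?_
  rw [l2_const_mul _ (by fun_prop)]
  refine (mul_le_mul_right (l2_conv_eweight_le hσ hσ2 hc) _).trans (le_of_eq ?_)
  ring

/-- The weight of `H^s` is distributed over the three factors: this is the fractional Leibniz rule
for the trilinear majorant. -/
theorem eweight_mul_trimaj_le {s : ℝ} (hs : 0 ≤ s) {a b c : Plane → ℝ≥0∞}
    (ha : Measurable a) (hb : Measurable b) (hc : Measurable c) (ξ : Plane) :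
    eweight s ξ * trimaj a b c ξ ≤ ENNReal.ofReal (9 ^ (s / 2)) *
      (trimaj (fun η ↦ eweight s η * a η) b c ξ + trimaj a (fun η ↦ eweight s η * b η) c ξ
        + trimaj a b (fun η ↦ eweight s η * c η) ξ) := by
  -- `F` is kept opaque, so that `fun_prop` and `simp` do not unfold the integrands
  obtain ⟨F, hF⟩ : ∃ F : (Plane → ℝ≥0∞) → (Plane → ℝ≥0∞) → (Plane → ℝ≥0∞) → Plane → ℝ≥0∞,
      ∀ a b c ζ, F a b c ζ = ∫⁻ η, eweight (-2) ζ * (a η * b (η + ζ) * c (ξ - ζ)) :=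
    ⟨_, fun _ _ _ _ ↦ rfl⟩
  have hexp : ∀ {a b c : Plane → ℝ≥0∞}, Measurable a → Measurable b → Measurable c →
      trimaj a b c ξ = ∫⁻ ζ, F a b c ζ := by
    intro a b c ha hb hc
    rw [trimaj, conv]
    refine lintegral_congr fun ζ ↦ ?_
    rw [corr, hF, lintegral_const_mul _ (by fun_prop), lintegral_mul_const _ (by fun_prop),
      mul_assoc]
  have hm : ∀ {a b c : Plane → ℝ≥0∞}, Measurable a → Measurable b → Measurable c →
      Measurable (F a b c) := by
    intro a b c ha hb hc
    rw [funext (hF a b c)]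
    refine Measurable.lintegral_prod_right' (f := fun z : Plane × Plane ↦
      eweight (-2) z.1 * (a z.2 * b (z.2 + z.1) * c (ξ - z.1))) ?_
    fun_prop
  have m0 := hm ha hb hc
  have m1 := hm (a := fun η ↦ eweight s η * a η) (by fun_prop) hb hc
  have m2 := hm (b := fun η ↦ eweight s η * b η) ha (by fun_prop) hc
  have m3 := hm (c := fun η ↦ eweight s η * c η) ha hb (by fun_prop)
  rw [hexp ha hb hc, hexp (by fun_prop) hb hc, hexp ha (by fun_prop) hc, hexp ha hb (by fun_prop),
    ← lintegral_add_left m1, ← lintegral_add_right _ m3, ← lintegral_const_mul _ m0,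
    ← lintegral_const_mul _ (by fun_prop)]
  refine lintegral_mono fun ζ ↦ ?_
  simp only [hF]
  rw [← lintegral_add_left (by fun_prop), ← lintegral_add_left (by fun_prop),
    ← lintegral_const_mul _ (by fun_prop), ← lintegral_const_mul _ (by fun_prop)]
  refine lintegral_mono fun η ↦ ?_
  have hw : eweight s ξ ≤ ENNReal.ofReal (9 ^ (s / 2)) *
      (eweight s η + eweight s (η + ζ) + eweight s (ξ - ζ)) := by
    have h := weight_add_add_le hs (-η) (η + ζ) (ξ - ζ)
    have e : -η + (η + ζ) + (ξ - ζ) = ξ := by abel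
    rw [e, weight_even] at h
    refine (ENNReal.ofReal_le_ofReal h).trans (le_of_eq ?_)
    rw [ENNReal.ofReal_mul (by positivity), ENNReal.ofReal_add
      (add_pos (weight_pos _ _) (weight_pos _ _)).le (weight_pos _ _).le,
      ENNReal.ofReal_add (weight_pos _ _).le (weight_pos _ _).le]
    rfl
  refine (mul_le_mul_left hw _).trans (le_of_eq ?_)
  ring

/-- The trilinear estimate in `H^s` with the low norms in `L²` and `H^σ`. -/
theorem l2_eweight_trimaj_le {s σ : ℝ} (hs : 0 ≤ s) (hσ : 0 < σ) (hσ2 : σ ≤ 2)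
    {a b c : Plane → ℝ≥0∞} (ha : Measurable a) (hb : Measurable b) (hc : Measurable c) :
    l2 (fun ξ ↦ eweight s ξ * trimaj a b c ξ) ≤
      ENNReal.ofReal (9 ^ (s / 2)) * (ENNReal.ofReal (1 / σ) *
        (l2 (fun ξ ↦ eweight s ξ * a ξ) * l2 b * l2 (fun ξ ↦ eweight σ ξ * c ξ)
        + l2 a * l2 (fun ξ ↦ eweight s ξ * b ξ) * l2 (fun ξ ↦ eweight σ ξ * c ξ)
        + l2 (fun ξ ↦ eweight σ ξ * a ξ) * l2 b * l2 (fun ξ ↦ eweight s ξ * c ξ))) := by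
  refine (l2_mono (Eventually.of_forall (eweight_mul_trimaj_le hs ha hb hc))).trans ?_
  rw [l2_const_mul _ (by fun_prop)]
  refine mul_le_mul_right ?_ _
  refine (l2_add_le (by fun_prop) (by fun_prop)).trans ?_
  refine (add_le_add_left (l2_add_le (by fun_prop) (by fun_prop)) _).trans ?_
  rw [mul_add, mul_add]
  refine add_le_add (add_le_add ?_ ?_) ?_
  · exact l2_trimaj_le_third hσ hσ2 (by fun_prop) hb hc
  · exact l2_trimaj_le_third hσ hσ2 ha (by fun_prop) hc
  · exact l2_trimaj_le_first hσ hσ2 ha hb (by fun_prop)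

/-! ### Multiplication operators, translations and the Fourier transform on `L²` -/

theorem memLp_mul {A : Plane → Spinor →L[ℂ] Spinor} (hA : Continuous A) {C : ℝ}
    (hC : ∀ ξ, ‖A ξ‖ ≤ C) (f : L2) : MemLp (fun ξ ↦ A ξ (f ξ)) 2 (volume : Measure Plane) :=
  (Lp.memLp f).of_le_mul (aestronglyMeasurable_clm_apply hA (Lp.aestronglyMeasurable f))
    (Eventually.of_forall fun ξ ↦ (A ξ).le_of_opNorm_le (hC ξ) _)

/-- Multiplication by a bounded continuous matrix-valued function, as an operator on
`L²(ℝ²; ℂ²)`. -/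
def mulOp (A : Plane → Spinor →L[ℂ] Spinor) (hA : Continuous A) (C : ℝ) (hC : ∀ ξ, ‖A ξ‖ ≤ C) :
    L2 →L[ℂ] L2 :=
  LinearMap.mkContinuous
    { toFun := fun f ↦ (memLp_mul hA hC f).toLp _
      map_add' := fun f g ↦ by
        rw [← MemLp.toLp_add]
        refine MemLp.toLp_congr _ _ ?_
        filter_upwards [Lp.coeFn_add f g] with ξ h
        exact (congrArg (A ξ) h).trans (map_add (A ξ) _ _)
      map_smul' := fun c f ↦ by
        rw [RingHom.id_apply, ← MemLp.toLp_const_smul]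
        refine MemLp.toLp_congr _ _ ?_
        filter_upwards [Lp.coeFn_smul c f] with ξ h
        exact (congrArg (A ξ) h).trans (map_smul (A ξ) _ _) }
    C fun f ↦ by
      refine Lp.norm_le_mul_norm_of_ae_le_mul ?_
      filter_upwards [(memLp_mul hA hC f).coeFn_toLp] with ξ h
      simp only [LinearMap.coe_mk, AddHom.coe_mk]
      rw [h]
      exact (A ξ).le_of_opNorm_le (hC ξ) _

section MulOp

variable {A B : Plane → Spinor →L[ℂ] Spinor} {hA : Continuous A} {hB : Continuous B} {C D : ℝ}
  {hC : ∀ ξ, ‖A ξ‖ ≤ C} {hD : ∀ ξ, ‖B ξ‖ ≤ D}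

theorem coeFn_mulOp (f : L2) : mulOp A hA C hC f =ᵐ[volume] fun ξ ↦ A ξ (f ξ) :=
  (memLp_mul hA hC f).coeFn_toLp

theorem norm_mulOp_le (f : L2) : ‖mulOp A hA C hC f‖ ≤ C * ‖f‖ := by
  refine Lp.norm_le_mul_norm_of_ae_le_mul ?_
  filter_upwards [coeFn_mulOp (hA := hA) (hC := hC) f] with ξ h
  rw [h]
  exact (A ξ).le_of_opNorm_le (hC ξ) _

theorem mulOp_comm (h : ∀ ξ v, A ξ (B ξ v) = B ξ (A ξ v)) (f : L2) :
    mulOp A hA C hC (mulOp B hB D hD f) = mulOp B hB D hD (mulOp A hA C hC f) := by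
  ext1
  filter_upwards [coeFn_mulOp (hA := hA) (hC := hC) f, coeFn_mulOp (hA := hB) (hC := hD) f,
    coeFn_mulOp (hA := hA) (hC := hC) (mulOp B hB D hD f),
    coeFn_mulOp (hA := hB) (hC := hD) (mulOp A hA C hC f)] with ξ h1 h2 h3 h4
  rw [h3, h4, h1, h2, h]

end MulOp

/-- A constant matrix, acting on `L²(ℝ²; ℂ²)`. -/
def constOp (L : Spinor →L[ℂ] Spinor) : L2 →L[ℂ] L2 :=
  mulOp (fun _ ↦ L) continuous_const ‖L‖ fun _ ↦ le_rfl

theorem coeFn_constOp (L : Spinor →L[ℂ] Spinor) (f : L2) :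
    constOp L f =ᵐ[volume] fun ξ ↦ L (f ξ) := coeFn_mulOp f

/-- Multiplication by the character `x ↦ e^{-2πi⟨x, ζ⟩}`, composed with a constant matrix. -/
def modulation (L : Spinor →L[ℂ] Spinor) (ζ : Plane) : L2 →L[ℂ] L2 :=
  mulOp (fun x ↦ (Real.fourierChar (-inner ℝ x ζ) : ℂ) • L)
    (by
      have h : Continuous fun x : Plane ↦ Real.fourierChar (-inner ℝ x ζ) :=
        Real.continuous_fourierChar.comp (by fun_prop)
      fun_prop)
    ‖L‖ fun x ↦ by rw [norm_smul, Circle.norm_coe, one_mul]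

theorem coeFn_modulation (L : Spinor →L[ℂ] Spinor) (ζ : Plane) (f : L2) :
    modulation L ζ f =ᵐ[volume] fun x ↦ (Real.fourierChar (-inner ℝ x ζ) : ℂ) • L (f x) :=
  coeFn_mulOp f

/-- The translation `f ↦ f(· + ζ)` on `L²(ℝ²; ℂ²)`. -/
def translation (ζ : Plane) : L2 → L2 :=
  Lp.compMeasurePreserving (fun ξ ↦ ξ + ζ) (measurePreserving_add_right volume ζ)

theorem coeFn_translation (ζ : Plane) (f : L2) :
    translation ζ f =ᵐ[volume] fun ξ ↦ f (ξ + ζ) :=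
  Lp.coeFn_compMeasurePreserving f _

theorem continuous_translation (ζ : Plane) : Continuous (translation ζ) :=
  (Lp.isometry_compMeasurePreserving _).continuous

/-- For Schwartz functions `inner_modulation` is the self-adjointness of the Fourier integral
together with its inversion formula. -/
theorem integral_inner_modulation_schwartz (L : Spinor →L[ℂ] Spinor) (ζ : Plane)
    (f g : 𝓢(Plane, Spinor)) :
    ∫ x, inner ℂ (f x) ((Real.fourierChar (-inner ℝ x ζ) : ℂ) • L (g x))
      = ∫ η, inner ℂ (𝓕 f η) (L (𝓕 g (η + ζ))) := by
  set G : Plane → Spinor := fun η ↦ L (𝓕 g η) with hG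
  have hGint : Integrable G := L.integrable_comp (𝓕 g).integrable
  have key := VectorFourier.integral_sesq_fourierIntegral_eq_neg_flip (innerSL ℂ (E := Spinor))
    (L := innerₗ Plane) Real.continuous_fourierChar continuous_inner
    (f.integrable (μ := volume)) (g := G ∘ fun η ↦ η + ζ) (hGint.comp_add_right ζ)
  rw [VectorFourier.fourierIntegral_comp_add_right] at key
  have hinv : ∀ x, VectorFourier.fourierIntegral Real.fourierChar volume (-(innerₗ Plane).flip) G x
      = L (g x) := by
    intro x
    have h1 : 𝓕⁻ (⇑(𝓕 g : 𝓢(Plane, Spinor))) x = g x := by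
      rw [← SchwartzMap.fourierInv_coe, FourierTransform.fourierInv_fourier_eq]
    rw [← h1, Real.fourierInv_eq, ← L.integral_comp_comm]
    · rw [VectorFourier.fourierIntegral]
      refine integral_congr_ae (Eventually.of_forall fun v ↦ ?_)
      simp [hG, Circle.smul_def, real_inner_comm]
    · have := (Real.fourierIntegral_convergent_iff (μ := volume) (f := ⇑(𝓕 g : 𝓢(Plane, Spinor)))
        (-x)).2 (𝓕 g).integrable
      simpa using this
  simp only [hinv] at key
  refine Eq.trans ?_ key.symm
  refine integral_congr_ae (Eventually.of_forall fun x ↦ ?_)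
  simp [Circle.smul_def, real_inner_comm]

/-- The Fourier transform turns modulations into translations, in weak form. Both sides are
continuous on `L² × L²`, so it suffices to consider Schwartz functions. -/
theorem inner_modulation (L : Spinor →L[ℂ] Spinor) (ζ : Plane) (ψ φ : L2) :
    inner ℂ ψ (modulation L ζ φ)
      = inner ℂ (𝓕 ψ : L2) (constOp L (translation ζ (𝓕 φ : L2))) := by
  have hF : Continuous fun f : L2 ↦ (𝓕 f : L2) := (Lp.fourierTransformₗᵢ Plane Spinor).continuous
  have hd : DenseRange (SchwartzMap.toLpCLM ℂ (E := Plane) Spinor 2 volume) :=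
    SchwartzMap.denseRange_toLpCLM ENNReal.ofNat_ne_top
  refine DenseRange.induction_on₂ (p := fun ψ φ : L2 ↦ inner ℂ ψ (modulation L ζ φ)
      = inner ℂ (𝓕 ψ : L2) (constOp L (translation ζ (𝓕 φ : L2)))) hd ?_ ?_ ψ φ
  · refine isClosed_eq ?_ ?_
    · exact continuous_fst.inner ((modulation L ζ).continuous.comp continuous_snd)
    · exact (hF.comp continuous_fst).inner ((constOp L).continuous.comp
        ((continuous_translation ζ).comp (hF.comp continuous_snd)))
  · intro f g
    simp only [SchwartzMap.toLpCLM_apply]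
    rw [SchwartzMap.toLp_fourier_eq, SchwartzMap.toLp_fourier_eq, L2.inner_def, L2.inner_def]
    refine Eq.trans ?_ ((integral_inner_modulation_schwartz L ζ f g).trans ?_)
    · refine integral_congr_ae ?_
      filter_upwards [coeFn_modulation L ζ (g.toLp 2), f.coeFn_toLp 2, g.coeFn_toLp 2]
        with x h1 h2 h3
      rw [h1, h2, h3]
    · refine integral_congr_ae ?_
      filter_upwards [coeFn_constOp L (translation ζ ((𝓕 g).toLp 2)),
        coeFn_translation ζ ((𝓕 g).toLp 2), (𝓕 f).coeFn_toLp 2,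
        (measurePreserving_add_right volume ζ).quasiMeasurePreserving.ae
          ((𝓕 g).coeFn_toLp 2 volume)]
        with x h1 h2 h3 h4
      rw [h1, h2, h3, h4]

/-- The Fourier transform commutes with constant matrices. -/
theorem fourier_constOp (L : Spinor →L[ℂ] Spinor) (φ : L2) :
    (𝓕 (constOp L φ) : L2) = constOp L (𝓕 φ : L2) := by
  refine ext_inner_left ℂ fun h ↦ ?_
  have h1 := inner_modulation L 0 (𝓕⁻ h : L2) φ
  have e1 : modulation L 0 φ = constOp L φ := by
    ext1
    filter_upwards [coeFn_modulation L 0 φ, coeFn_constOp L φ] with x h1 h2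
    rw [h1, h2]; simp
  have e2 : translation 0 (𝓕 φ : L2) = 𝓕 φ := by
    ext1
    filter_upwards [coeFn_translation 0 (𝓕 φ : L2)] with x h1
    rw [h1, add_zero]
  have e3 : (𝓕 (𝓕⁻ h : L2) : L2) = h := FourierTransform.fourier_fourierInv_eq h
  rw [e1, e2, e3] at h1
  rw [← h1, ← Lp.inner_fourier_eq (𝓕⁻ h : L2), e3]

/-- The correlation `∫ ⟨f(η), g(η + ζ)⟩ dη` of two spinor fields. -/
def correlation (f g : L2) (ζ : Plane) : ℂ := ∫ η, inner ℂ (f η) (g (η + ζ))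

theorem correlation_eq_inner (f g : L2) (ζ : Plane) :
    correlation f g ζ = inner ℂ f (translation ζ g) := by
  rw [L2.inner_def]
  refine integral_congr_ae ?_
  filter_upwards [coeFn_translation ζ g] with η h
  rw [h]

/-- The Fourier transform of `⟨ψ, φ⟩` is the correlation of the Fourier transforms. -/
theorem fourier_inner (ψ φ : L2) (ζ : Plane) :
    𝓕 (fun x ↦ inner ℂ (ψ x) (φ x)) ζ = correlation (𝓕 ψ : L2) (𝓕 φ : L2) ζ := by
  have h := inner_modulation (ContinuousLinearMap.id ℂ Spinor) ζ ψ φ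
  have e : constOp (ContinuousLinearMap.id ℂ Spinor) (translation ζ (𝓕 φ : L2))
      = translation ζ (𝓕 φ : L2) := by
    ext1
    filter_upwards [coeFn_constOp (ContinuousLinearMap.id ℂ Spinor)
      (translation ζ (𝓕 φ : L2))] with x h1
    rw [h1]; rfl
  rw [correlation_eq_inner, ← e, ← h, L2.inner_def, Real.fourier_eq]
  refine integral_congr_ae ?_
  filter_upwards [coeFn_modulation (ContinuousLinearMap.id ℂ Spinor) ζ φ] with x h1
  rw [h1, inner_smul_right, Circle.smul_def, smul_eq_mul]
  rfl

theorem continuous_correlation (f g : L2) : Continuous (correlation f g) := by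
  have e : correlation f g = 𝓕 (fun x ↦ inner ℂ ((𝓕⁻ f : L2) x) ((𝓕⁻ g : L2) x)) := by
    ext ζ
    rw [fourier_inner, FourierTransform.fourier_fourierInv_eq,
      FourierTransform.fourier_fourierInv_eq]
  rw [e]
  exact VectorFourier.fourierIntegral_continuous Real.continuous_fourierChar
    (by exact continuous_inner) (L2.integrable_inner _ _)

theorem enorm_inner_le (v w : Spinor) : ‖inner ℂ v w‖ₑ ≤ ‖v‖ₑ * ‖w‖ₑ := by
  simpa [enorm_eq_nnnorm, ← ENNReal.coe_mul] using nnnorm_inner_le_nnnorm (𝕜 := ℂ) v w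

theorem enorm_correlation_le (f g : L2) (ζ : Plane) :
    ‖correlation f g ζ‖ₑ ≤ corr (fun η ↦ ‖f η‖ₑ) (fun η ↦ ‖g η‖ₑ) ζ := by
  refine (enorm_integral_le_lintegral_enorm _).trans (lintegral_mono fun η ↦ ?_)
  exact enorm_inner_le _ _

@[fun_prop]
theorem measurable_enorm_coeFn (f : L2) : Measurable fun ξ ↦ ‖f ξ‖ₑ :=
  (Lp.stronglyMeasurable f).enorm

/-! ### The Fourier transform of a product -/

theorem aestronglyMeasurable_vconv {V : Plane → ℂ} (hV : Continuous V) (g : L2) :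
    AEStronglyMeasurable (fun z : Plane × Plane ↦ V z.2 • g (z.1 - z.2))
      (volume.prod volume) := by
  refine StronglyMeasurable.aestronglyMeasurable ?_
  exact (hV.comp continuous_snd).stronglyMeasurable.smul
    ((Lp.stronglyMeasurable g).comp_measurable (measurable_fst.sub measurable_snd))

theorem enorm_vconv_le (V : Plane → ℂ) (g : L2) (ξ : Plane) :
    ‖∫ ζ, V ζ • g (ξ - ζ)‖ₑ ≤ conv (fun ζ ↦ ‖V ζ‖ₑ) (fun ζ ↦ ‖g ζ‖ₑ) ξ := by
  refine (enorm_integral_le_lintegral_enorm _).trans (le_of_eq ?_)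
  exact lintegral_congr fun ζ ↦ enorm_smul _ _

theorem l2_enorm_ne_top (g : L2) : l2 (fun ξ ↦ ‖g ξ‖ₑ) ≠ ∞ := by
  rw [← eLpNorm_two_eq_l2]
  exact (Lp.memLp g).eLpNorm_ne_top

theorem memLp_vconv {V : Plane → ℂ} (hV : Continuous V) (hVi : Integrable V) (g : L2) :
    MemLp (fun ξ ↦ ∫ ζ, V ζ • g (ξ - ζ)) 2 (volume : Measure Plane) := by
  refine ⟨(aestronglyMeasurable_vconv hV g).integral_prod_right', ?_⟩
  rw [eLpNorm_two_eq_l2]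
  refine (l2_mono (Eventually.of_forall (enorm_vconv_le V g))).trans_lt ?_
  refine (l2_conv_le (by fun_prop) (by fun_prop)).trans_lt ?_
  exact ENNReal.mul_lt_top hVi.2 (l2_enorm_ne_top g).lt_top

theorem integrable_inner_vconv {V : Plane → ℂ} (hV : Continuous V) (hVi : Integrable V)
    (u g : L2) : Integrable (fun z : Plane × Plane ↦
      inner ℂ (u z.1) (V z.2 • g (z.1 - z.2))) (volume.prod volume) := by
  have hm : AEStronglyMeasurable
      (fun z : Plane × Plane ↦ inner ℂ (u z.1) (V z.2 • g (z.1 - z.2)))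
      (volume.prod volume) :=
    (Lp.aestronglyMeasurable u).comp_fst.inner (aestronglyMeasurable_vconv hV g)
  have hbound : ∫⁻ η, ∫⁻ ζ, ‖inner ℂ (u η) (V ζ • g (η - ζ))‖ₑ < ∞ := by
    refine lt_of_le_of_lt (b := ∫⁻ η, ‖u η‖ₑ *
      conv (fun ζ ↦ ‖V ζ‖ₑ) (fun ζ ↦ ‖g ζ‖ₑ) η) ?_ ?_
    · refine lintegral_mono fun η ↦ ?_
      have hmeas : Measurable fun ζ ↦ ‖V ζ‖ₑ * ‖g (η - ζ)‖ₑ :=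
        hV.enorm.measurable.mul
          ((measurable_enorm_coeFn g).comp (measurable_const.sub measurable_id))
      rw [conv, ← lintegral_const_mul _ hmeas]
      refine lintegral_mono fun ζ ↦ ?_
      exact (enorm_inner_le _ _).trans_eq (by rw [enorm_smul])
    · refine (lintegral_mul_le_l2 (a := fun η ↦ ‖u η‖ₑ)
        (b := conv (fun ζ ↦ ‖V ζ‖ₑ) (fun ζ ↦ ‖g ζ‖ₑ)) (by fun_prop)
        (by fun_prop)).trans_lt ?_
      refine ENNReal.mul_lt_top (l2_enorm_ne_top u).lt_top ?_
      refine (l2_conv_le (by fun_prop) (by fun_prop)).trans_lt ?_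
      exact ENNReal.mul_lt_top hVi.2 (l2_enorm_ne_top _).lt_top
  refine ⟨hm, ?_⟩
  rw [HasFiniteIntegral, lintegral_prod _ hm.enorm]
  exact hbound

theorem ae_integrable_vconv {V : Plane → ℂ} (hV : Continuous V) (hVi : Integrable V) (g : L2) :
    ∀ᵐ η, Integrable fun ζ ↦ V ζ • g (η - ζ) := by
  have hf : ∀ᵐ η, conv (fun ζ ↦ ‖V ζ‖ₑ) (fun ζ ↦ ‖g ζ‖ₑ) η ^ (2 : ℝ) < ∞ := by
    refine ae_lt_top (by fun_prop) ?_
    rw [← l2_sq]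
    refine ENNReal.rpow_ne_top_of_nonneg (by norm_num) (ne_top_of_le_ne_top ?_
      (l2_conv_le (by fun_prop) (by fun_prop)))
    exact ENNReal.mul_ne_top hVi.2.ne (l2_enorm_ne_top _)
  filter_upwards [hf] with η hη
  refine ⟨(hV.stronglyMeasurable.smul ((Lp.stronglyMeasurable _).comp_measurable
    (measurable_const.sub measurable_id))).aestronglyMeasurable, ?_⟩
  rw [HasFiniteIntegral]
  simp_rw [enorm_smul]
  by_contra hcon
  rw [not_lt, top_le_iff] at hcon
  rw [conv, hcon] at hη
  simp at hη

/-- The Fourier transform of the product of `𝓕⁻ V` and `φ` is the convolution of `V` and `𝓕 φ`.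
Both sides are tested against an element of `L²`; the integrals over the frequency of `V` are
exchanged with the other ones by Fubini's theorem. -/
theorem fourier_mul {V : Plane → ℂ} (hV : Continuous V) (hVi : Integrable V) (φ : L2)
    (h : MemLp (fun x ↦ (𝓕⁻ V x) • φ x) 2 (volume : Measure Plane)) :
    (𝓕 (h.toLp _) : L2) = (memLp_vconv hV hVi (𝓕 φ : L2)).toLp _ := by
  refine ext_inner_left ℂ fun u ↦ ?_
  set u' : L2 := 𝓕⁻ u with hu'
  have hu : (𝓕 u' : L2) = u := FourierTransform.fourier_fourierInv_eq u
  rw [← hu, Lp.inner_fourier_eq, L2.inner_def, L2.inner_def]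
  have e1 : ∫ x, inner ℂ (u' x) (h.toLp _ x)
      = ∫ x, ∫ ζ, (V ζ * Real.fourierChar (inner ℝ ζ x)) * inner ℂ (u' x) (φ x) := by
    refine integral_congr_ae ?_
    filter_upwards [h.coeFn_toLp] with x hx
    rw [hx, inner_smul_right, Real.fourierInv_eq, ← integral_mul_const]
    refine integral_congr_ae (Eventually.of_forall fun ζ ↦ ?_)
    simp only [Circle.smul_def, smul_eq_mul]
    ring
  have e2 : ∫ x, ∫ ζ, (V ζ * Real.fourierChar (inner ℝ ζ x)) * inner ℂ (u' x) (φ x)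
      = ∫ ζ, ∫ x, (V ζ * Real.fourierChar (inner ℝ ζ x)) * inner ℂ (u' x) (φ x) := by
    refine integral_integral_swap ?_
    have hi := (L2.integrable_inner (𝕜 := ℂ) u' φ).mul_prod hVi
    refine hi.norm.mono' ?_ (Eventually.of_forall fun z ↦ ?_)
    · refine AEStronglyMeasurable.mul ?_ ?_
      · refine Continuous.aestronglyMeasurable ?_
        refine (hV.comp continuous_snd).mul ?_
        have hc : Continuous fun z : Plane × Plane ↦ Real.fourierChar (inner ℝ z.2 z.1) :=
          Real.continuous_fourierChar.comp (continuous_snd.inner continuous_fst)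
        fun_prop
      · exact (L2.integrable_inner (𝕜 := ℂ) u' φ).1.comp_fst
    · rw [Function.uncurry, norm_mul, norm_mul, norm_mul, Circle.norm_coe, mul_one, mul_comm]
  have e3 : ∀ ζ, ∫ x, (V ζ * Real.fourierChar (inner ℝ ζ x)) * inner ℂ (u' x) (φ x)
      = ∫ η, inner ℂ (u η) (V ζ • (𝓕 φ : L2) (η - ζ)) := by
    intro ζ
    have := fourier_inner u' φ (-ζ)
    rw [Real.fourier_eq, correlation, hu] at this
    simp_rw [inner_smul_right, sub_eq_add_neg, integral_const_mul, ← this, mul_assoc]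
    rw [integral_const_mul]
    congr 1
    refine integral_congr_ae (Eventually.of_forall fun x ↦ ?_)
    simp [Circle.smul_def, real_inner_comm]
  have hint := integrable_inner_vconv hV hVi u (𝓕 φ : L2)
  have hae := ae_integrable_vconv hV hVi (𝓕 φ : L2)
  rw [e1, e2, integral_congr_ae (Eventually.of_forall e3), ← integral_integral_swap hint, hu]
  refine integral_congr_ae ?_
  filter_upwards [(memLp_vconv hV hVi (𝓕 φ : L2)).coeFn_toLp, hae] with η h1 h2
  rw [h1, integral_inner h2]

/-! ### The nonlinearity on the Fourier side -/

theorem l2_congr {a b : Plane → ℝ≥0∞} (h : a =ᵐ[volume] b) : l2 a = l2 b :=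
  le_antisymm (l2_mono (h.mono fun _ h ↦ h.le)) (l2_mono (h.mono fun _ h ↦ h.ge))

theorem enorm_eq_l2 (f : L2) : ‖f‖ₑ = l2 fun ξ ↦ ‖f ξ‖ₑ := by
  rw [Lp.enorm_def, eLpNorm_two_eq_l2]

/-- The function `(b + (2π|ζ|)²)⁻¹ ∫ ⟨f(η), g(η + ζ)⟩ dη`. For `f = g = 𝓕 ψ` it is the Fourier
transform of the potential `(b - Δ)⁻¹ |ψ|²`. -/
def potentialHat (b : ℝ) (f g : L2) (ζ : Plane) : ℂ :=
  ((b + (2 * Real.pi * ‖ζ‖) ^ 2 : ℝ) : ℂ)⁻¹ * correlation f g ζ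

theorem potentialFourier_eq (b : ℝ) (ψ : L2) :
    potentialFourier b ψ = potentialHat b (𝓕 ψ : L2) (𝓕 ψ : L2) := by
  ext ζ
  rw [potentialFourier, potentialHat, ← fourier_inner]
  have : density ψ = fun x ↦ inner ℂ (ψ x) (ψ x) := by
    ext x
    rw [density, inner_self_eq_norm_sq_to_K]
    norm_cast
  rw [this]

theorem continuous_potentialHat {b : ℝ} (hb : 0 < b) (f g : L2) :
    Continuous (potentialHat b f g) := by
  refine Continuous.mul (Continuous.inv₀ (by fun_prop) fun ζ ↦ ?_) (continuous_correlation f g)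
  have : 0 < b + (2 * Real.pi * ‖ζ‖) ^ 2 := by positivity
  exact_mod_cast this.ne'

theorem enorm_potentialHat_le {b : ℝ} (hb : 0 < b) (f g : L2) (ζ : Plane) :
    ‖potentialHat b f g ζ‖ₑ ≤ ENNReal.ofReal (max 1 b⁻¹) *
      (eweight (-2) ζ * corr (fun η ↦ ‖f η‖ₑ) (fun η ↦ ‖g η‖ₑ) ζ) := by
  rw [potentialHat, enorm_mul, ← mul_assoc]
  refine mul_le_mul' ?_ (enorm_correlation_le f g ζ)
  rw [eweight, ← ENNReal.ofReal_mul (by positivity), ← ofReal_norm]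
  refine ENNReal.ofReal_le_ofReal ?_
  have hx : 0 ≤ (2 * Real.pi * ‖ζ‖) ^ 2 := by positivity
  have hw : weight (-2) ζ = (1 + (2 * Real.pi * ‖ζ‖) ^ 2)⁻¹ := by
    rw [← weight_two]
    exact eq_inv_of_mul_eq_one_left (weight_neg_mul_self 2 ζ)
  rw [norm_inv, Complex.norm_real, Real.norm_of_nonneg (by positivity), hw, ← div_eq_mul_inv,
    inv_eq_one_div, div_le_div_iff₀ (by positivity) (by positivity)]
  have h1 : 1 ≤ max 1 b⁻¹ * b := by
    refine le_trans (le_of_eq (inv_mul_cancel₀ hb.ne').symm) ?_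
    exact mul_le_mul_of_nonneg_right (le_max_right _ _) hb.le
  nlinarith [le_max_left 1 b⁻¹, mul_le_mul_of_nonneg_right (le_max_left 1 b⁻¹) hx]

theorem integrable_potentialHat {b σ : ℝ} (hb : 0 < b) (hσ : 0 < σ) (hσ2 : σ ≤ 2) {f g : L2}
    (hf : l2 (fun ξ ↦ eweight σ ξ * ‖f ξ‖ₑ) ≠ ∞) : Integrable (potentialHat b f g) := by
  refine ⟨(continuous_potentialHat hb f g).aestronglyMeasurable, ?_⟩
  refine (lintegral_mono (enorm_potentialHat_le hb f g)).trans_lt ?_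
  rw [lintegral_const_mul _ (by fun_prop)]
  refine ENNReal.mul_lt_top ENNReal.ofReal_lt_top
    ((lintegral_eweight_mul_corr_le hσ hσ2 (by fun_prop) (by fun_prop)).trans_lt ?_)
  exact ENNReal.mul_lt_top (ENNReal.mul_lt_top ENNReal.ofReal_lt_top hf.lt_top)
    (l2_enorm_ne_top g).lt_top

theorem potentialHat_sub (b : ℝ) (f g : L2) (ζ : Plane) :
    potentialHat b f f ζ - potentialHat b g g ζ
      = potentialHat b (f - g) f ζ + potentialHat b g (f - g) ζ := by
  have h : translation ζ (f - g) = translation ζ f - translation ζ g := map_sub _ _ _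
  simp only [potentialHat, correlation_eq_inner, h, inner_sub_left, inner_sub_right]
  ring

theorem norm_act_gamma0 (v : Spinor) : ‖act gamma0 v‖ = ‖v‖ := by
  have hu : gamma0 ∈ unitary (Matrix (Fin 2) (Fin 2) ℂ) := by
    rw [Unitary.mem_iff, Matrix.star_eq_conjTranspose]
    constructor <;> ext i j <;> fin_cases i <;> fin_cases j <;>
      simp [gamma0, Matrix.mul_apply, Matrix.conjTranspose_apply]
  exact ContinuousLinearMap.norm_map_of_mem_unitary (Unitary.map_mem _ hu) v

theorem enorm_act_gamma0 (v : Spinor) : ‖act gamma0 v‖ₑ = ‖v‖ₑ := by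
  rw [← ofReal_norm, norm_act_gamma0, ofReal_norm]

/-- The Fourier transform of the nonlinearity in terms of `f = 𝓕 ψ`. -/
def hartreeHat (b : ℝ) (f : L2) (ξ : Plane) : Spinor :=
  ∫ ζ, potentialHat b f f ζ • constOp (act gamma0) f (ξ - ζ)

theorem ae_comp_sub_left {p : Plane → Prop} (h : ∀ᵐ η, p η) (ξ : Plane) : ∀ᵐ ζ, p (ξ - ζ) :=
  (Measure.measurePreserving_sub_left volume ξ).quasiMeasurePreserving.ae h

theorem const_mul_trimaj (C : ℝ≥0∞) {a b c : Plane → ℝ≥0∞} (ha : Measurable a) (hb : Measurable b)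
    (hc : Measurable c) (ξ : Plane) :
    C * trimaj a b c ξ = ∫⁻ ζ, C * (eweight (-2) ζ * corr a b ζ) * c (ξ - ζ) := by
  rw [trimaj, conv, ← lintegral_const_mul _ (by fun_prop)]
  exact lintegral_congr fun ζ ↦ (mul_assoc _ _ _).symm

theorem measurable_trimaj_integrand (C : ℝ≥0∞) {a b c : Plane → ℝ≥0∞} (ha : Measurable a)
    (hb : Measurable b) (hc : Measurable c) (ξ : Plane) :
    Measurable fun ζ ↦ C * (eweight (-2) ζ * corr a b ζ) * c (ξ - ζ) := by
  fun_prop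

theorem aestronglyMeasurable_hartreeHat {b : ℝ} (hb : 0 < b) (f : L2) :
    AEStronglyMeasurable (hartreeHat b f) volume :=
  (aestronglyMeasurable_vconv (continuous_potentialHat hb f f) _).integral_prod_right'

theorem enorm_hartreeHat_le {b : ℝ} (hb : 0 < b) (f : L2) (ξ : Plane) :
    ‖hartreeHat b f ξ‖ₑ ≤ ENNReal.ofReal (max 1 b⁻¹) *
      trimaj (fun η ↦ ‖f η‖ₑ) (fun η ↦ ‖f η‖ₑ) (fun η ↦ ‖f η‖ₑ) ξ := by
  have hm := measurable_enorm_coeFn f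
  rw [const_mul_trimaj _ hm hm hm]
  refine (enorm_integral_le_lintegral_enorm _).trans (lintegral_mono_ae ?_)
  filter_upwards [ae_comp_sub_left (coeFn_constOp (act gamma0) f) ξ] with ζ h
  rw [enorm_smul, h, enorm_act_gamma0]
  exact mul_le_mul_left (enorm_potentialHat_le hb f f ζ) _

/-- The difference of two values of a cubic form, written as a telescoping sum. The integrals have to
converge absolutely for their difference to be the integral of the difference; hence the hypotheses
on `f` and `g`. -/
theorem enorm_hartreeHat_sub_le {b σ : ℝ} (hb : 0 < b) (hσ : 0 < σ) (hσ2 : σ ≤ 2) {f g : L2}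
    (hf : l2 (fun ξ ↦ eweight σ ξ * ‖f ξ‖ₑ) ≠ ∞) (hg : l2 (fun ξ ↦ eweight σ ξ * ‖g ξ‖ₑ) ≠ ∞) :
    ∀ᵐ ξ, ‖hartreeHat b f ξ - hartreeHat b g ξ‖ₑ ≤ ENNReal.ofReal (max 1 b⁻¹) *
      (trimaj (fun η ↦ ‖(f - g : L2) η‖ₑ) (fun η ↦ ‖f η‖ₑ) (fun η ↦ ‖f η‖ₑ) ξ
      + trimaj (fun η ↦ ‖g η‖ₑ) (fun η ↦ ‖(f - g : L2) η‖ₑ) (fun η ↦ ‖f η‖ₑ) ξ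
      + trimaj (fun η ↦ ‖g η‖ₑ) (fun η ↦ ‖g η‖ₑ) (fun η ↦ ‖(f - g : L2) η‖ₑ) ξ) := by
  filter_upwards [ae_integrable_vconv (continuous_potentialHat hb f f)
      (integrable_potentialHat hb hσ hσ2 hf) (constOp (act gamma0) f),
    ae_integrable_vconv (continuous_potentialHat hb g g)
      (integrable_potentialHat hb hσ hσ2 hg) (constOp (act gamma0) g)] with ξ h1 h2
  have mf := measurable_enorm_coeFn f
  have mg := measurable_enorm_coeFn g
  have md := measurable_enorm_coeFn (f - g)
  have m1 := measurable_trimaj_integrand (ENNReal.ofReal (max 1 b⁻¹)) md mf mf ξ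
  have m3 := measurable_trimaj_integrand (ENNReal.ofReal (max 1 b⁻¹)) mg mg md ξ
  rw [hartreeHat, hartreeHat, ← integral_sub h1 h2, mul_add, mul_add, const_mul_trimaj _ md mf mf,
    const_mul_trimaj _ mg md mf, const_mul_trimaj _ mg mg md, ← lintegral_add_left m1,
    ← lintegral_add_right _ m3]
  refine (enorm_integral_le_lintegral_enorm _).trans (lintegral_mono_ae ?_)
  filter_upwards [ae_comp_sub_left (coeFn_constOp (act gamma0) f) ξ,
    ae_comp_sub_left (coeFn_constOp (act gamma0) g) ξ,
    ae_comp_sub_left (Lp.coeFn_sub f g) ξ] with ζ e1 e2 e3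
  have e : potentialHat b f f ζ • act gamma0 (f (ξ - ζ)) - potentialHat b g g ζ •
      act gamma0 (g (ξ - ζ)) = (potentialHat b (f - g) f ζ) • act gamma0 (f (ξ - ζ))
      + (potentialHat b g (f - g) ζ) • act gamma0 (f (ξ - ζ))
      + potentialHat b g g ζ • act gamma0 ((f - g : L2) (ξ - ζ)) := by
    rw [e3, Pi.sub_apply, map_sub, ← add_smul, ← potentialHat_sub]
    module
  rw [e1, e2, e]
  refine (enorm_add_le _ _).trans ?_
  refine (add_le_add_left (enorm_add_le _ _) _).trans ?_
  rw [enorm_smul, enorm_smul, enorm_smul, enorm_act_gamma0, enorm_act_gamma0]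
  exact add_le_add (add_le_add (mul_le_mul_left (enorm_potentialHat_le hb _ _ ζ) _)
    (mul_le_mul_left (enorm_potentialHat_le hb _ _ ζ) _))
    (mul_le_mul_left (enorm_potentialHat_le hb _ _ ζ) _)

/-- The hypothesis, `ψ ∈ H^σ`, makes the inverse Fourier integral that defines the potential
absolutely convergent. -/
theorem fourier_nonlinearity {b σ : ℝ} (hb : 0 < b) (hσ : 0 < σ) (hσ2 : σ ≤ 2) {ψ : L2}
    (hψ : l2 (fun ξ ↦ eweight σ ξ * ‖(𝓕 ψ : L2) ξ‖ₑ) ≠ ∞) :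
    (𝓕 (nonlinearity b ψ) : L2) =ᵐ[volume] hartreeHat b (𝓕 ψ : L2) := by
  have hV := continuous_potentialHat hb (𝓕 ψ : L2) (𝓕 ψ : L2)
  have hVi := integrable_potentialHat hb hσ hσ2 (g := (𝓕 ψ : L2)) hψ
  have hae : (fun x ↦ potential b ψ x • act gamma0 (ψ x)) =ᵐ[volume]
      fun x ↦ (𝓕⁻ (potentialHat b (𝓕 ψ : L2) (𝓕 ψ : L2)) x) • constOp (act gamma0) ψ x := by
    filter_upwards [coeFn_constOp (act gamma0) ψ] with x hx
    rw [hx, potential, potentialFourier_eq]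
  have hm := (memLp_congr_ae hae).1 (memLp_nonlinearity b ψ)
  have e1 : nonlinearity b ψ = hm.toLp _ := MemLp.toLp_congr _ _ hae
  rw [e1, fourier_mul hV hVi _ hm, fourier_constOp]
  exact MemLp.coeFn_toLp _

/-! ### The Sobolev space on the Fourier side -/

theorem norm_smul_id_le {c C : ℝ} (hc : 0 ≤ c) (h : c ≤ C) :
    ‖(c : ℂ) • ContinuousLinearMap.id ℂ Spinor‖ ≤ C := by
  rw [norm_smul, Complex.norm_real, Real.norm_of_nonneg hc]
  exact (mul_le_of_le_one_right hc ContinuousLinearMap.norm_id_le).trans h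

/-- Multiplication by `(1 + (2π|ξ|)²)^{-s/2}` on `L²`. The space `H^s` corresponds on the Fourier
side to the range of this operator, and the `H^s` norm to the `L²` norm of the preimage. -/
def bessel {s : ℝ} (hs : 0 < s) : L2 →L[ℂ] L2 :=
  mulOp (fun ξ ↦ (weight (-s) ξ : ℂ) • ContinuousLinearMap.id ℂ Spinor)
    (by have := continuous_weight (-s); fun_prop) 1
    fun ξ ↦ norm_smul_id_le (weight_pos _ ξ).le
      ((weight_mono (by linarith) ξ).trans_eq (weight_zero ξ))

section Bessel

variable {s : ℝ} (hs : 0 < s)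

theorem coeFn_bessel (g : L2) : bessel hs g =ᵐ[volume] fun ξ ↦ (weight (-s) ξ : ℂ) • g ξ :=
  coeFn_mulOp g

theorem norm_bessel_le (g : L2) : ‖bessel hs g‖ ≤ ‖g‖ :=
  (norm_mulOp_le g).trans_eq (one_mul _)

theorem eq_weight_smul_bessel (g : L2) :
    g =ᵐ[volume] fun ξ ↦ (weight s ξ : ℂ) • bessel hs g ξ := by
  filter_upwards [coeFn_bessel hs g] with ξ h
  rw [h, smul_smul, ← Complex.ofReal_mul, mul_comm, weight_neg_mul_self]
  simp

theorem enorm_weight_smul (r : ℝ) (ξ : Plane) (v : Spinor) :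
    ‖(weight r ξ : ℂ) • v‖ₑ = eweight r ξ * ‖v‖ₑ := by
  rw [enorm_smul, ← ofReal_norm, Complex.norm_real, Real.norm_of_nonneg (weight_pos r ξ).le]
  rfl

theorem l2_eweight_bessel (g : L2) :
    l2 (fun ξ ↦ eweight s ξ * ‖bessel hs g ξ‖ₑ) = ‖g‖ₑ := by
  rw [enorm_eq_l2]
  refine l2_congr ?_
  filter_upwards [eq_weight_smul_bessel hs g] with ξ h
  rw [h, enorm_weight_smul]

theorem bessel_injective : Function.Injective (bessel hs) := by
  intro g g' h
  ext1
  filter_upwards [eq_weight_smul_bessel hs g, eq_weight_smul_bessel hs g'] with ξ h1 h2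
  rw [h1, h2, h]

theorem l2_eweight_bessel_le {σ : ℝ} (hσs : σ ≤ s) (g : L2) :
    l2 (fun ξ ↦ eweight σ ξ * ‖bessel hs g ξ‖ₑ) ≤ ‖g‖ₑ := by
  rw [← l2_eweight_bessel hs g]
  exact l2_mono (Eventually.of_forall fun ξ ↦ mul_le_mul_left (eweight_mono hσs ξ) _)

/-- Logarithmic interpolation: for `σ = O(1/log A)` the factor `A ^ (σ / s)` is bounded. -/
theorem l2_eweight_bessel_le_interpolation {σ A : ℝ} (hσs : σ ≤ s) (hσ : 0 ≤ σ) (hA : 0 < A)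
    (g : L2) : l2 (fun ξ ↦ eweight σ ξ * ‖bessel hs g ξ‖ₑ)
      ≤ ENNReal.ofReal (A ^ (σ / s)) * (‖bessel hs g‖ₑ + ENNReal.ofReal A⁻¹ * ‖g‖ₑ) := by
  have h : ∀ ξ, eweight σ ξ * ‖bessel hs g ξ‖ₑ ≤ ENNReal.ofReal (A ^ (σ / s)) *
      (‖bessel hs g ξ‖ₑ + ENNReal.ofReal A⁻¹ * (eweight s ξ * ‖bessel hs g ξ‖ₑ)) := by
    intro ξ
    have h1 := ENNReal.ofReal_le_ofReal (weight_le_interpolation hs hσs hσ hA ξ)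
    rw [ENNReal.ofReal_mul (by positivity), ENNReal.ofReal_add zero_le_one
      (mul_nonneg (inv_pos.2 hA).le (weight_pos s ξ).le), ENNReal.ofReal_mul (inv_pos.2 hA).le,
      ENNReal.ofReal_one] at h1
    refine (mul_le_mul_left h1 _).trans (le_of_eq ?_)
    rw [eweight]
    ring
  refine (l2_mono (Eventually.of_forall h)).trans ?_
  rw [l2_const_mul _ (by fun_prop)]
  refine mul_le_mul_right ((l2_add_le (by fun_prop) (by fun_prop)).trans ?_) _
  rw [l2_const_mul _ (by fun_prop), l2_eweight_bessel, ← enorm_eq_l2]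

theorem l2_eweight_trimaj_bessel_le {σ : ℝ} (hσ : 0 < σ) (hσ2 : σ ≤ 2) (g₁ g₂ g₃ : L2) :
    l2 (fun ξ ↦ eweight s ξ * trimaj (fun η ↦ ‖bessel hs g₁ η‖ₑ) (fun η ↦ ‖bessel hs g₂ η‖ₑ)
        (fun η ↦ ‖bessel hs g₃ η‖ₑ) ξ) ≤
      ENNReal.ofReal (9 ^ (s / 2)) * (ENNReal.ofReal (1 / σ) *
        (‖g₁‖ₑ * ‖bessel hs g₂‖ₑ * l2 (fun ξ ↦ eweight σ ξ * ‖bessel hs g₃ ξ‖ₑ)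
        + ‖bessel hs g₁‖ₑ * ‖g₂‖ₑ * l2 (fun ξ ↦ eweight σ ξ * ‖bessel hs g₃ ξ‖ₑ)
        + l2 (fun ξ ↦ eweight σ ξ * ‖bessel hs g₁ ξ‖ₑ) * ‖bessel hs g₂‖ₑ * ‖g₃‖ₑ)) := by
  have := l2_eweight_trimaj_le hs.le hσ hσ2 (measurable_enorm_coeFn (bessel hs g₁))
    (measurable_enorm_coeFn (bessel hs g₂)) (measurable_enorm_coeFn (bessel hs g₃))
  simpa only [l2_eweight_bessel, ← enorm_eq_l2] using this

theorem enorm_bessel_le (g : L2) : ‖bessel hs g‖ₑ ≤ ‖g‖ₑ := by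
  rw [← ofReal_norm, ← ofReal_norm]
  exact ENNReal.ofReal_le_ofReal (norm_bessel_le hs g)

/-- The trilinear estimate with all norms in `H^s`. -/
theorem l2_eweight_trimaj_bessel_le' (g₁ g₂ g₃ : L2) :
    l2 (fun ξ ↦ eweight s ξ * trimaj (fun η ↦ ‖bessel hs g₁ η‖ₑ) (fun η ↦ ‖bessel hs g₂ η‖ₑ)
        (fun η ↦ ‖bessel hs g₃ η‖ₑ) ξ) ≤
      ENNReal.ofReal (9 ^ (s / 2) * (1 / min s 2) * 3) * (‖g₁‖ₑ * ‖g₂‖ₑ * ‖g₃‖ₑ) := by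
  have hσ : 0 < min s 2 := lt_min hs two_pos
  have h1 := l2_eweight_bessel_le hs (min_le_left s 2) g₁
  have h3 := l2_eweight_bessel_le hs (min_le_left s 2) g₃
  have k1 := enorm_bessel_le hs g₁
  have k2 := enorm_bessel_le hs g₂
  calc _ ≤ _ := l2_eweight_trimaj_bessel_le hs hσ (min_le_right _ _) g₁ g₂ g₃
    _ ≤ ENNReal.ofReal (9 ^ (s / 2)) * (ENNReal.ofReal (1 / min s 2) *
        (‖g₁‖ₑ * ‖g₂‖ₑ * ‖g₃‖ₑ + ‖g₁‖ₑ * ‖g₂‖ₑ * ‖g₃‖ₑ + ‖g₁‖ₑ * ‖g₂‖ₑ * ‖g₃‖ₑ)) := by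
      gcongr
    _ = _ := by
      rw [ENNReal.ofReal_mul (by positivity), ENNReal.ofReal_mul (by positivity),
        ENNReal.ofReal_ofNat]
      ring

theorem l2_bessel_ne_top {σ : ℝ} (hσs : σ ≤ s) (g : L2) :
    l2 (fun ξ ↦ eweight σ ξ * ‖bessel hs g ξ‖ₑ) ≠ ∞ :=
  ne_top_of_le_ne_top enorm_ne_top (l2_eweight_bessel_le hs hσs g)

theorem hsNorm_of_fourier_eq_bessel {f g : L2} (h : (𝓕 f : L2) = bessel hs g) :
    hsNorm s f = ‖g‖ₑ := by
  rw [hsNorm, h, Lp.enorm_def]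
  refine eLpNorm_congr_ae ?_
  filter_upwards [eq_weight_smul_bessel hs g] with ξ h
  rw [h, Complex.coe_smul]
  rfl

theorem memHs_iff_exists_bessel {f : L2} : MemHs s f ↔ ∃ g, (𝓕 f : L2) = bessel hs g := by
  rw [← hsNorm_lt_top_iff]
  constructor
  · intro h
    have hm : MemLp (fun ξ ↦ (weight s ξ : ℂ) • (𝓕 f : L2) ξ) 2 (volume : Measure Plane) := by
      refine ⟨?_, h⟩
      exact ((Complex.continuous_ofReal.comp (continuous_weight s)).aestronglyMeasurable).smul
        (Lp.aestronglyMeasurable _)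
    refine ⟨hm.toLp _, ?_⟩
    ext1
    filter_upwards [coeFn_bessel hs (hm.toLp _), hm.coeFn_toLp] with ξ h1 h2
    rw [h1, h2, smul_smul, ← Complex.ofReal_mul, weight_neg_mul_self]
    simp
  · rintro ⟨g, hg⟩
    rw [hsNorm_of_fourier_eq_bessel hs hg]
    exact enorm_lt_top

end Bessel

/-! ### The nonlinearity as a map of `H^s` -/

theorem l2_const_mul_add_three_le (C : ℝ≥0∞) {a b c : Plane → ℝ≥0∞} (ha : Measurable a)
    (hb : Measurable b) (hc : Measurable c) :
    l2 (fun ξ ↦ C * (a ξ + b ξ + c ξ)) ≤ C * (l2 a + l2 b + l2 c) := by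
  rw [l2_const_mul _ (by fun_prop)]
  refine mul_le_mul_right ((l2_add_le (by fun_prop) hc).trans ?_) _
  exact add_le_add_left (l2_add_le ha hb) _

theorem measurable_eweight_mul_trimaj (s : ℝ) {a b c : Plane → ℝ≥0∞} (ha : Measurable a)
    (hb : Measurable b) (hc : Measurable c) :
    Measurable fun ξ ↦ eweight s ξ * trimaj a b c ξ :=
  (measurable_eweight s).mul (measurable_trimaj ha hb hc)

theorem memLp_weight_hartreeHat {s b : ℝ} (hs : 0 < s) (hb : 0 < b) (g : L2) :
    MemLp (fun ξ ↦ (weight s ξ : ℂ) • hartreeHat b (bessel hs g) ξ) 2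
      (volume : Measure Plane) := by
  refine ⟨((Complex.continuous_ofReal.comp (continuous_weight s)).aestronglyMeasurable).smul
    (aestronglyMeasurable_hartreeHat hb _), ?_⟩
  rw [eLpNorm_two_eq_l2]
  have hm := measurable_enorm_coeFn (bessel hs g)
  have h : ∀ ξ, ‖(weight s ξ : ℂ) • hartreeHat b (bessel hs g) ξ‖ₑ ≤
      ENNReal.ofReal (max 1 b⁻¹) * (eweight s ξ * trimaj (fun η ↦ ‖bessel hs g η‖ₑ)
        (fun η ↦ ‖bessel hs g η‖ₑ) (fun η ↦ ‖bessel hs g η‖ₑ) ξ) := by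
    intro ξ
    rw [enorm_weight_smul, mul_left_comm]
    exact mul_le_mul_right (enorm_hartreeHat_le hb _ ξ) _
  refine (l2_mono (Eventually.of_forall h)).trans_lt ?_
  rw [l2_const_mul _ (measurable_eweight_mul_trimaj s hm hm hm)]
  refine ENNReal.mul_lt_top ENNReal.ofReal_lt_top
    ((l2_eweight_trimaj_bessel_le' hs g g g).trans_lt ?_)
  exact ENNReal.mul_lt_top ENNReal.ofReal_lt_top
    (ENNReal.mul_lt_top (ENNReal.mul_lt_top enorm_lt_top enorm_lt_top) enorm_lt_top)

/-- The nonlinearity as a map of `H^s`, in terms of `g = (1 + (2π|ξ|)²)^{s/2} 𝓕 ψ`. -/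
def hartreeMap {s b : ℝ} (hs : 0 < s) (hb : 0 < b) (g : L2) : L2 :=
  (memLp_weight_hartreeHat hs hb g).toLp _

section NonlinearMap

variable {s b : ℝ} (hs : 0 < s) (hb : 0 < b)

theorem coeFn_hartreeMap (g : L2) :
    hartreeMap hs hb g =ᵐ[volume] fun ξ ↦ (weight s ξ : ℂ) • hartreeHat b (bessel hs g) ξ :=
  MemLp.coeFn_toLp _

theorem bessel_hartreeMap (g : L2) :
    bessel hs (hartreeMap hs hb g) = (𝓕 (nonlinearity b (𝓕⁻ (bessel hs g) : L2)) : L2) := by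
  have e : (𝓕 (𝓕⁻ (bessel hs g) : L2) : L2) = bessel hs g :=
    FourierTransform.fourier_fourierInv_eq _
  have hσ : 0 < min s 2 := lt_min hs two_pos
  have h := fourier_nonlinearity hb hσ (min_le_right s 2) (ψ := 𝓕⁻ (bessel hs g))
    (by rw [e]; exact l2_bessel_ne_top hs (min_le_left s 2) g)
  rw [e] at h
  ext1
  filter_upwards [h, coeFn_hartreeMap hs hb g, coeFn_bessel hs (hartreeMap hs hb g)]
    with ξ h1 h2 h3
  rw [h1, h3, h2, smul_smul, ← Complex.ofReal_mul, weight_neg_mul_self]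
  simp

/-- The constant of the trilinear estimate in `H^s`. -/
def triConst (s b : ℝ) : ℝ := max 1 b⁻¹ * (9 ^ (s / 2) * (1 / min s 2) * 3)

theorem triConst_nonneg {s b : ℝ} (hs : 0 < s) : 0 ≤ triConst s b := by
  have hσ : 0 < min s 2 := lt_min hs two_pos
  unfold triConst; positivity

theorem enorm_hartreeMap_sub_le (g g' : L2) :
    ‖hartreeMap hs hb g - hartreeMap hs hb g'‖ₑ ≤ ENNReal.ofReal (triConst s b) *
      (‖g - g'‖ₑ * ‖g‖ₑ * ‖g‖ₑ + ‖g'‖ₑ * ‖g - g'‖ₑ * ‖g‖ₑ + ‖g'‖ₑ * ‖g'‖ₑ * ‖g - g'‖ₑ) := by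
  have hσ : 0 < min s 2 := lt_min hs two_pos
  have hfin := fun g ↦ l2_bessel_ne_top hs (min_le_left s 2) g
  have mf := measurable_enorm_coeFn (bessel hs g)
  have mg := measurable_enorm_coeFn (bessel hs g')
  have md := measurable_enorm_coeFn (bessel hs (g - g'))
  have t1 := measurable_eweight_mul_trimaj s md mf mf
  have t2 := measurable_eweight_mul_trimaj s mg md mf
  have t3 := measurable_eweight_mul_trimaj s mg mg md
  have hae : ∀ᵐ ξ, ‖(hartreeMap hs hb g - hartreeMap hs hb g' : L2) ξ‖ₑ ≤
      ENNReal.ofReal (max 1 b⁻¹) * (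
        eweight s ξ * trimaj (fun η ↦ ‖bessel hs (g - g') η‖ₑ) (fun η ↦ ‖bessel hs g η‖ₑ)
          (fun η ↦ ‖bessel hs g η‖ₑ) ξ
        + eweight s ξ * trimaj (fun η ↦ ‖bessel hs g' η‖ₑ) (fun η ↦ ‖bessel hs (g - g') η‖ₑ)
          (fun η ↦ ‖bessel hs g η‖ₑ) ξ
        + eweight s ξ * trimaj (fun η ↦ ‖bessel hs g' η‖ₑ) (fun η ↦ ‖bessel hs g' η‖ₑ)
          (fun η ↦ ‖bessel hs (g - g') η‖ₑ) ξ) := by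
    have key := enorm_hartreeHat_sub_le hb hσ (min_le_right s 2) (hfin g) (hfin g')
    rw [← map_sub] at key
    filter_upwards [key, Lp.coeFn_sub (hartreeMap hs hb g) (hartreeMap hs hb g'),
      coeFn_hartreeMap hs hb g, coeFn_hartreeMap hs hb g'] with ξ h1 h2 h3 h4
    rw [h2, Pi.sub_apply, h3, h4, ← smul_sub, enorm_weight_smul, ← mul_add, ← mul_add,
      mul_left_comm]
    exact mul_le_mul_right h1 _
  rw [enorm_eq_l2]
  refine (l2_mono hae).trans ?_
  refine (l2_const_mul_add_three_le _ t1 t2 t3).trans ?_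
  rw [triConst, ENNReal.ofReal_mul (by positivity), mul_assoc]
  refine mul_le_mul_right ?_ _
  rw [mul_add, mul_add]
  exact add_le_add (add_le_add (l2_eweight_trimaj_bessel_le' hs _ _ _)
    (l2_eweight_trimaj_bessel_le' hs _ _ _)) (l2_eweight_trimaj_bessel_le' hs _ _ _)

theorem norm_hartreeMap_sub_le {R : ℝ} {g g' : L2} (hg : ‖g‖ ≤ R) (hg' : ‖g'‖ ≤ R) :
    ‖hartreeMap hs hb g - hartreeMap hs hb g'‖ ≤ triConst s b * (3 * R ^ 2) * ‖g - g'‖ := by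
  have hR : 0 ≤ R := (norm_nonneg _).trans hg
  have h := enorm_hartreeMap_sub_le hs hb g g'
  simp only [← ofReal_norm] at h
  rw [← ENNReal.ofReal_mul (by positivity), ← ENNReal.ofReal_mul (by positivity),
    ← ENNReal.ofReal_mul (by positivity), ← ENNReal.ofReal_mul (by positivity),
    ← ENNReal.ofReal_mul (by positivity), ← ENNReal.ofReal_mul (by positivity),
    ← ENNReal.ofReal_add (by positivity) (by positivity),
    ← ENNReal.ofReal_add (by positivity) (by positivity),
    ← ENNReal.ofReal_mul (triConst_nonneg hs),
    ENNReal.ofReal_le_ofReal_iff (mul_nonneg (triConst_nonneg hs) (by positivity))] at h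
  refine h.trans ?_
  rw [mul_assoc (triConst s b)]
  refine mul_le_mul_of_nonneg_left ?_ (triConst_nonneg hs)
  calc ‖g - g'‖ * ‖g‖ * ‖g‖ + ‖g'‖ * ‖g - g'‖ * ‖g‖ + ‖g'‖ * ‖g'‖ * ‖g - g'‖
      ≤ ‖g - g'‖ * R * R + R * ‖g - g'‖ * R + R * R * ‖g - g'‖ := by gcongr
    _ = 3 * R ^ 2 * ‖g - g'‖ := by ring

theorem le_mul_of_ofReal_le_mul {n p q r x y z : ℝ} (hp : 0 ≤ p) (hq : 0 ≤ q) (hr : 0 ≤ r)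
    (hx : 0 ≤ x) (hy : 0 ≤ y) (hz : 0 ≤ z)
    (h : ENNReal.ofReal n ≤ ENNReal.ofReal p * (ENNReal.ofReal q * (ENNReal.ofReal r *
      (ENNReal.ofReal 3 * (ENNReal.ofReal x * ENNReal.ofReal y * ENNReal.ofReal z))))) :
    n ≤ p * (q * (r * (3 * (x * y * z)))) := by
  rwa [← ENNReal.ofReal_mul hx, ← ENNReal.ofReal_mul (by positivity),
    ← ENNReal.ofReal_mul (by positivity), ← ENNReal.ofReal_mul hr, ← ENNReal.ofReal_mul hq,
    ← ENNReal.ofReal_mul hp, ENNReal.ofReal_le_ofReal_iff (by positivity)] at h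

/-- The estimate `‖N(ψ)‖_{H^s} ≲ σ⁻¹ ‖ψ‖_{L²} ‖ψ‖_{H^σ} ‖ψ‖_{H^s}` of the nonlinearity. -/
theorem enorm_hartreeMap_le {σ : ℝ} (hσ : 0 < σ) (hσ2 : σ ≤ 2) (g : L2) :
    ‖hartreeMap hs hb g‖ₑ ≤ ENNReal.ofReal (max 1 b⁻¹) * (ENNReal.ofReal (9 ^ (s / 2)) *
      (ENNReal.ofReal (1 / σ) * (ENNReal.ofReal 3 *
        (‖g‖ₑ * ‖bessel hs g‖ₑ * l2 (fun ξ ↦ eweight σ ξ * ‖bessel hs g ξ‖ₑ))))) := by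
  have hm := measurable_enorm_coeFn (bessel hs g)
  have hae : ∀ᵐ ξ, ‖hartreeMap hs hb g ξ‖ₑ ≤ ENNReal.ofReal (max 1 b⁻¹) *
      (eweight s ξ * trimaj (fun η ↦ ‖bessel hs g η‖ₑ) (fun η ↦ ‖bessel hs g η‖ₑ)
          (fun η ↦ ‖bessel hs g η‖ₑ) ξ) := by
    filter_upwards [coeFn_hartreeMap hs hb g] with ξ h
    rw [h, enorm_weight_smul, mul_left_comm]
    exact mul_le_mul_right (enorm_hartreeHat_le hb _ ξ) _
  rw [enorm_eq_l2]
  refine (l2_mono hae).trans ?_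
  rw [l2_const_mul _ (measurable_eweight_mul_trimaj s hm hm hm)]
  refine mul_le_mul_right ((l2_eweight_trimaj_bessel_le hs hσ hσ2 g g g).trans (le_of_eq ?_)) _
  rw [ENNReal.ofReal_ofNat]
  ring

/-- The nonlinearity grows only logarithmically faster than linearly in `H^s`, on sets that are
bounded in `L²`. In the estimate `‖N(ψ)‖_{H^s} ≲ σ⁻¹ ‖ψ‖_{L²} ‖ψ‖_{H^σ} ‖ψ‖_{H^s}` the regularity
`σ = min(s, 2) / log A` with `A = e + ‖ψ‖_{H^s}` keeps `‖ψ‖_{H^σ}` bounded. -/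
theorem norm_hartreeMap_le (g : L2) :
    ‖hartreeMap hs hb g‖ ≤ triConst s b * (Real.exp 1 * (‖bessel hs g‖ * (‖bessel hs g‖ + 1))) *
      (Real.log (Real.exp 1 + ‖g‖) * ‖g‖) := by
  set A := Real.exp 1 + ‖g‖ with hA
  have hApos : 0 < A := by positivity
  have hlog : 1 ≤ Real.log A := by
    rw [Real.le_log_iff_exp_le hApos, hA]
    linarith [norm_nonneg g]
  have hm : 0 < min s 2 := lt_min hs two_pos
  set σ := min s 2 / Real.log A with hσdef
  have hσ : 0 < σ := by positivity
  have hσm : σ ≤ min s 2 := div_le_self hm.le hlog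
  have hσs : σ ≤ s := hσm.trans (min_le_left _ _)
  have hσ2 : σ ≤ 2 := hσm.trans (min_le_right _ _)
  set M := ‖bessel hs g‖ with hM
  have hAσ : A ^ (σ / s) ≤ Real.exp 1 := by
    rw [Real.rpow_def_of_pos hApos]
    refine Real.exp_le_exp.2 ?_
    have e : Real.log A * (σ / s) = min s 2 / s := by
      rw [hσdef]; field_simp
    rw [e, div_le_one hs]
    exact min_le_left _ _
  have hlow : l2 (fun ξ ↦ eweight σ ξ * ‖bessel hs g ξ‖ₑ)
      ≤ ENNReal.ofReal (Real.exp 1 * (M + 1)) := by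
    refine (l2_eweight_bessel_le_interpolation hs hσs hσ.le hApos g).trans ?_
    rw [← ofReal_norm, ← ofReal_norm, ← ENNReal.ofReal_mul (by positivity),
      ← ENNReal.ofReal_add (by positivity) (by positivity), ← ENNReal.ofReal_mul (by positivity)]
    refine ENNReal.ofReal_le_ofReal ?_
    have h1 : A⁻¹ * ‖g‖ ≤ 1 := by
      rw [inv_mul_le_iff₀ hApos, mul_one, hA]
      linarith [Real.exp_pos 1]
    gcongr
  have e : 1 / σ = 1 / min s 2 * Real.log A := by
    rw [hσdef]; field_simp
  clear_value σ
  have hfin := (enorm_hartreeMap_le hs hb hσ hσ2 g).trans (mul_le_mul_right (mul_le_mul_right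
    (mul_le_mul_right (mul_le_mul_right (mul_le_mul_right hlow _) _) _) _) _)
  rw [← ofReal_norm, ← ofReal_norm, ← ofReal_norm, ← hM] at hfin
  replace hfin := le_mul_of_ofReal_le_mul (by positivity) (by positivity) (by positivity)
    (norm_nonneg g) (norm_nonneg _) (by positivity) hfin
  refine hfin.trans (le_of_eq ?_)
  rw [e, triConst]
  ring

/-! ### Conservation of charge -/

theorem conj_potentialFourier (b : ℝ) (ψ : L2) (ξ : Plane) :
    (starRingEnd ℂ) (potentialFourier b ψ ξ) = potentialFourier b ψ (-ξ) := by
  rw [potentialFourier, potentialFourier, map_mul, map_inv₀, Complex.conj_ofReal, norm_neg,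
    Real.fourier_eq, Real.fourier_eq, ← integral_conj]
  congr 1
  refine integral_congr_ae (Eventually.of_forall fun x ↦ ?_)
  simp only [Circle.smul_def, smul_eq_mul, map_mul, density, Complex.conj_ofReal]
  rw [← Circle.coe_inv_eq_conj, ← AddChar.map_neg_eq_inv, inner_neg_right]

/-- The potential `(b - Δ)⁻¹ |ψ|²` is real. -/
theorem conj_potential (b : ℝ) (ψ : L2) (x : Plane) :
    (starRingEnd ℂ) (potential b ψ x) = potential b ψ x := by
  rw [potential, Real.fourierInv_eq, ← integral_conj, ← integral_neg_eq_self]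
  refine integral_congr_ae (Eventually.of_forall fun ξ ↦ ?_)
  simp only [Circle.smul_def, smul_eq_mul, map_mul]
  rw [conj_potentialFourier, neg_neg, ← Circle.coe_inv_eq_conj, ← AddChar.map_neg_eq_inv,
    inner_neg_left, neg_neg]

theorem conj_inner_act_gamma0 (v : Spinor) :
    (starRingEnd ℂ) (inner ℂ v (act gamma0 v)) = inner ℂ v (act gamma0 v) := by
  have h : star (act gamma0) = act gamma0 := by
    rw [act, ← map_star, Matrix.star_eq_conjTranspose]
    congr 1
    ext i j
    fin_cases i <;> fin_cases j <;> simp [gamma0, Matrix.conjTranspose_apply]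
  rw [inner_conj_symm]
  nth_rewrite 1 [← h]
  rw [ContinuousLinearMap.star_eq_adjoint, ContinuousLinearMap.adjoint_inner_left]

theorem re_inner_I_smul_nonlinearity (b : ℝ) (ψ : L2) :
    (inner ℂ ψ (Complex.I • nonlinearity b ψ)).re = 0 := by
  have h : (starRingEnd ℂ) (inner ℂ ψ (nonlinearity b ψ)) = inner ℂ ψ (nonlinearity b ψ) := by
    rw [L2.inner_def, ← integral_conj]
    refine integral_congr_ae ?_
    filter_upwards [(memLp_nonlinearity b ψ).coeFn_toLp] with x hx
    rw [nonlinearity, hx, inner_smul_right, map_mul, conj_potential, conj_inner_act_gamma0]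
  rw [inner_smul_right, Complex.I_mul_re, Complex.conj_eq_iff_im.1 h, neg_zero]

theorem re_inner_bessel_I_smul_hartreeMap (g : L2) :
    (inner ℂ (bessel hs g) (bessel hs (Complex.I • hartreeMap hs hb g))).re = 0 := by
  have e : (𝓕 (𝓕⁻ (bessel hs g) : L2) : L2) = bessel hs g :=
    FourierTransform.fourier_fourierInv_eq _
  rw [map_smul, bessel_hartreeMap, inner_smul_right]
  nth_rewrite 1 [← e]
  rw [Lp.inner_fourier_eq, ← inner_smul_right]
  exact re_inner_I_smul_nonlinearity b _

end NonlinearMap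

/-! ### The free propagator on the Fourier side -/

/-- The free propagator `e^{-i t D_m}` on the Fourier side. -/
def evolution (m t : ℝ) : L2 →L[ℂ] L2 :=
  mulOp (fun ξ ↦ act (propagatorSymbol m t ξ)) (continuous_act_propagatorSymbol m t) 1 fun ξ ↦
    ContinuousLinearMap.opNorm_le_bound _ zero_le_one fun v ↦
      ((norm_act_propagatorSymbol m t ξ v).trans (one_mul _).symm).le

theorem coeFn_evolution (m t : ℝ) (f : L2) :
    evolution m t f =ᵐ[volume] fun ξ ↦ act (propagatorSymbol m t ξ) (f ξ) := coeFn_mulOp f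

theorem propagator_eq (m t : ℝ) (f : L2) : propagator m t f = 𝓕⁻ (evolution m t (𝓕 f : L2)) := rfl

theorem norm_evolution (m t : ℝ) (f : L2) : ‖evolution m t f‖ = ‖f‖ := by
  have h : ‖evolution m t f‖ₑ = ‖f‖ₑ := by
    rw [Lp.enorm_def, Lp.enorm_def]
    refine eLpNorm_congr_norm_ae ?_
    filter_upwards [coeFn_evolution m t f] with ξ h
    rw [h, norm_act_propagatorSymbol]
  rwa [← ofReal_norm, ← ofReal_norm, ENNReal.ofReal_eq_ofReal_iff (norm_nonneg _)
    (norm_nonneg _)] at h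

theorem act_propagatorSymbol_add (m t r : ℝ) (ξ : Plane) (v : Spinor) :
    act (propagatorSymbol m t ξ) (act (propagatorSymbol m r ξ) v)
      = act (propagatorSymbol m (t + r) ξ) v := by
  have h : propagatorSymbol m (t + r) ξ = propagatorSymbol m t ξ * propagatorSymbol m r ξ := by
    rw [propagatorSymbol, propagatorSymbol, propagatorSymbol, ← Matrix.exp_add_of_commute]
    · rw [← add_smul]; push_cast; congr 2; ring
    · exact ((Commute.refl _).smul_left _).smul_right _
  rw [h, act, act, act, map_mul]
  rfl

theorem evolution_evolution (m t r : ℝ) (f : L2) :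
    evolution m t (evolution m r f) = evolution m (t + r) f := by
  ext1
  filter_upwards [coeFn_evolution m t (evolution m r f), coeFn_evolution m r f,
    coeFn_evolution m (t + r) f] with ξ h1 h2 h3
  rw [h1, h2, h3, act_propagatorSymbol_add]

theorem evolution_zero (m : ℝ) (f : L2) : evolution m 0 f = f := by
  ext1
  filter_upwards [coeFn_evolution m 0 f] with ξ h
  rw [h, propagatorSymbol]
  simp [act]

theorem evolution_neg_evolution (m t : ℝ) (f : L2) : evolution m (-t) (evolution m t f) = f := by
  rw [evolution_evolution, neg_add_cancel, evolution_zero]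

theorem evolution_evolution_neg (m t : ℝ) (f : L2) : evolution m t (evolution m (-t) f) = f := by
  rw [evolution_evolution, add_neg_cancel, evolution_zero]

theorem bessel_evolution {s : ℝ} (hs : 0 < s) (m t : ℝ) (g : L2) :
    bessel hs (evolution m t g) = evolution m t (bessel hs g) :=
  mulOp_comm (fun ξ v ↦ by simp) g

theorem inner_evolution_neg (m t : ℝ) (f h : L2) :
    inner ℂ f (evolution m (-t) h) = inner ℂ (evolution m t f) h := by
  let e : L2 →ₗᵢ[ℂ] L2 := ⟨(evolution m t).toLinearMap, norm_evolution m t⟩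
  have h1 : inner ℂ (evolution m t f) (evolution m t (evolution m (-t) h))
      = inner ℂ f (evolution m (-t) h) := e.inner_map_map f (evolution m (-t) h)
  rw [← h1, evolution_evolution_neg]

theorem continuous_act_propagatorSymbol_time (m : ℝ) (ξ : Plane) (v : Spinor) :
    Continuous fun t ↦ act (propagatorSymbol m t ξ) v := by
  have hL : Continuous (Matrix.toEuclideanCLM (n := Fin 2) (𝕜 := ℂ)) :=
    LinearMap.continuous_of_finiteDimensional
      (Matrix.toEuclideanCLM (n := Fin 2) (𝕜 := ℂ)).toAlgEquiv.toLinearMap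
  let _ : NormedRing (Matrix (Fin 2) (Fin 2) ℂ) := Matrix.linftyOpNormedRing
  let _ : NormedAlgebra ℂ (Matrix (Fin 2) (Fin 2) ℂ) := Matrix.linftyOpNormedAlgebra
  let _ : NormedAlgebra ℚ (Matrix (Fin 2) (Fin 2) ℂ) := .restrictScalars ℚ ℂ _
  have h1 : Continuous fun t : ℝ ↦ (-(Complex.I * (t : ℂ))) • diracSymbol m ξ := by fun_prop
  have h2 : Continuous fun t : ℝ ↦ act (propagatorSymbol m t ξ) :=
    hL.comp (NormedSpace.exp_continuous.comp h1)
  exact h2.clm_apply continuous_const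

/-- Strong continuity of the propagator. As the propagator is isometric, it suffices that it is
weakly continuous, and this follows by dominated convergence. -/
theorem continuous_evolution (m : ℝ) (f : L2) : Continuous fun t ↦ evolution m t f := by
  rw [continuous_iff_continuousAt]
  intro t₀
  have hw : Continuous fun t ↦ inner ℂ (evolution m t f) (evolution m t₀ f) := by
    have e : ∀ t, inner ℂ (evolution m t f) (evolution m t₀ f)
        = ∫ ξ, inner ℂ (act (propagatorSymbol m t ξ) (f ξ)) (evolution m t₀ f ξ) := by
      intro t
      rw [L2.inner_def]
      refine integral_congr_ae ?_
      filter_upwards [coeFn_evolution m t f] with ξ h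
      rw [h]
    simp_rw [e]
    refine continuous_of_dominated (bound := fun ξ ↦ ‖f ξ‖ * ‖evolution m t₀ f ξ‖)
      (fun t ↦ ?_) (fun t ↦ Eventually.of_forall fun ξ ↦ ?_) ?_ (Eventually.of_forall fun ξ ↦ ?_)
    · exact (memLp_propagatorSymbol m t f).1.inner (Lp.aestronglyMeasurable _)
    · refine (norm_inner_le_norm _ _).trans_eq ?_
      rw [norm_act_propagatorSymbol]
    · exact (Lp.memLp f).norm.integrable_mul (Lp.memLp (evolution m t₀ f)).norm
    · exact (continuous_act_propagatorSymbol_time m ξ (f ξ)).inner continuous_const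
  rw [ContinuousAt, tendsto_iff_norm_sub_tendsto_zero]
  have hsq : ∀ t, ‖evolution m t f - evolution m t₀ f‖ = Real.sqrt
      (‖f‖ ^ 2 - 2 * (inner ℂ (evolution m t f) (evolution m t₀ f)).re + ‖f‖ ^ 2) := by
    intro t
    have := norm_sub_sq (𝕜 := ℂ) (evolution m t f) (evolution m t₀ f)
    rw [norm_evolution, norm_evolution] at this
    rw [← Real.sqrt_sq (norm_nonneg (evolution m t f - evolution m t₀ f)), this]
    rfl
  have hc : Continuous fun t ↦ Real.sqrt
      (‖f‖ ^ 2 - 2 * (inner ℂ (evolution m t f) (evolution m t₀ f)).re + ‖f‖ ^ 2) :=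
    Real.continuous_sqrt.comp ((continuous_const.sub (continuous_const.mul
      (Complex.continuous_re.comp hw))).add continuous_const)
  simp_rw [← hsq] at hc
  have := hc.tendsto t₀
  rwa [sub_self, norm_zero] at this

theorem continuous_evolution_uncurry (m : ℝ) :
    Continuous fun p : ℝ × L2 ↦ evolution m p.1 p.2 :=
  continuous_prod_of_continuous_lipschitzWith' _ 1
    (fun t ↦ LipschitzWith.of_dist_le_mul fun (f g : L2) ↦ by
      change dist (evolution m t f) (evolution m t g) ≤ _
      rw [dist_eq_norm, dist_eq_norm, NNReal.coe_one, one_mul, ← map_sub, norm_evolution])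
    (fun f ↦ continuous_evolution m f)

theorem continuousOn_evolution (m : ℝ) {c : ℝ → ℝ} {g : ℝ → L2} {S : Set ℝ}
    (hc : ContinuousOn c S) (hg : ContinuousOn g S) :
    ContinuousOn (fun t ↦ evolution m (c t) (g t)) S :=
  Continuous.comp_continuousOn' (g := fun p : ℝ × L2 ↦ evolution m p.1 p.2)
    (f := fun t ↦ (c t, g t)) (continuous_evolution_uncurry m) (hc.prodMk hg)

/-! ### The interaction picture -/

section Field

open Set Metric
open scoped NNReal

variable {s b : ℝ} (hs : 0 < s) (hb : 0 < b)

theorem lipschitzOnWith_hartreeMap (R : ℝ) :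
    LipschitzOnWith (triConst s b * (3 * R ^ 2)).toNNReal (hartreeMap hs hb) (closedBall 0 R) := by
  refine LipschitzOnWith.of_dist_le_mul fun g hg g' hg' ↦ ?_
  rw [dist_eq_norm, dist_eq_norm,
    Real.coe_toNNReal _ (mul_nonneg (triConst_nonneg hs) (by positivity))]
  exact norm_hartreeMap_sub_le hs hb (mem_closedBall_zero_iff.1 hg) (mem_closedBall_zero_iff.1 hg')

theorem continuous_hartreeMap : Continuous (hartreeMap hs hb) := by
  rw [continuous_iff_continuousAt]
  intro g
  refine (lipschitzOnWith_hartreeMap hs hb (‖g‖ + 1)).continuousOn.continuousAt ?_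
  refine mem_of_superset (ball_mem_nhds g one_pos) fun g' hg' ↦ ?_
  rw [mem_closedBall_zero_iff]
  have := norm_sub_norm_le g' g
  rw [mem_ball, dist_eq_norm] at hg'
  linarith

/-- The vector field of the equation in the interaction picture, in the unknown
`g(t) = (1 + (2π|ξ|)²)^{s/2} e^{i t D_m(ξ)} 𝓕 ψ(t)`. -/
def field (m : ℝ) (t : ℝ) (g : L2) : L2 :=
  evolution m (-t) (Complex.I • hartreeMap hs hb (evolution m t g))

theorem continuous_field_uncurry (m : ℝ) :
    Continuous (Function.uncurry (field hs hb m)) := by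
  have h0 : Continuous fun p : ℝ × L2 ↦ hartreeMap hs hb (evolution m p.1 p.2) :=
    (continuous_hartreeMap hs hb).comp (continuous_evolution_uncurry m)
  have h1 : Continuous fun p : ℝ × L2 ↦
      Complex.I • hartreeMap hs hb (evolution m p.1 p.2) := h0.const_smul Complex.I
  exact Continuous.comp (g := fun p : ℝ × L2 ↦ evolution m p.1 p.2)
    (f := fun p : ℝ × L2 ↦ (-p.1, Complex.I • hartreeMap hs hb (evolution m p.1 p.2)))
    (continuous_evolution_uncurry m) ((continuous_fst.neg).prodMk h1)

theorem continuousOn_field (m : ℝ) {g : ℝ → L2} {S : Set ℝ} (hg : ContinuousOn g S) :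
    ContinuousOn (fun τ ↦ field hs hb m τ (g τ)) S :=
  Continuous.comp_continuousOn' (g := Function.uncurry (field hs hb m))
    (f := fun τ ↦ (τ, g τ)) (continuous_field_uncurry hs hb m) (continuousOn_id.prodMk hg)

theorem lipschitzOnWith_field (m R t : ℝ) :
    LipschitzOnWith (triConst s b * (3 * R ^ 2)).toNNReal (field hs hb m t)
      (closedBall 0 R) := by
  refine LipschitzOnWith.of_dist_le_mul fun g hg g' hg' ↦ ?_
  have hmem : ∀ {g : L2}, g ∈ closedBall 0 R → evolution m t g ∈ closedBall (0 : L2) R := by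
    intro g hg
    rwa [mem_closedBall_zero_iff, norm_evolution, ← mem_closedBall_zero_iff]
  have := (lipschitzOnWith_hartreeMap hs hb R).dist_le_mul _ (hmem hg) _ (hmem hg')
  rw [dist_eq_norm, dist_eq_norm, ← map_sub, norm_evolution] at this
  rw [dist_eq_norm, dist_eq_norm, field, field, ← map_sub, norm_evolution, ← smul_sub, norm_smul,
    Complex.norm_I, one_mul]
  exact this

theorem norm_field_le (m M : ℝ) : ∃ C, 0 ≤ C ∧ ∀ t g, ‖bessel hs g‖ ≤ M →
    ‖field hs hb m t g‖ ≤ C * (Real.log (Real.exp 1 + ‖g‖) * ‖g‖) := by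
  refine ⟨triConst s b * (Real.exp 1 * (|M| * (|M| + 1))),
    mul_nonneg (triConst_nonneg hs) (by positivity), fun t g hg ↦ ?_⟩
  have h := norm_hartreeMap_le hs hb (evolution m t g)
  rw [bessel_evolution, norm_evolution, norm_evolution] at h
  rw [field, norm_evolution, norm_smul, Complex.norm_I, one_mul]
  refine h.trans ?_
  have hM : ‖bessel hs g‖ ≤ |M| := hg.trans (le_abs_self M)
  have hlog : 0 ≤ Real.log (Real.exp 1 + ‖g‖) := Real.log_nonneg
    (by linarith [Real.add_one_le_exp (1 : ℝ), norm_nonneg g])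
  refine mul_le_mul_of_nonneg_right ?_ (by positivity)
  refine mul_le_mul_of_nonneg_left ?_ (triConst_nonneg hs)
  gcongr

theorem re_inner_bessel_field (m t : ℝ) (g : L2) :
    (inner ℂ (bessel hs g) (bessel hs (field hs hb m t g))).re = 0 := by
  rw [field, bessel_evolution, inner_evolution_neg, ← bessel_evolution]
  exact re_inner_bessel_I_smul_hartreeMap hs hb _

/-- The spinor field at time `t` that is described by `g` in the interaction picture. -/
def toPhysical (m t : ℝ) : L2 →L[ℂ] L2 :=
  (Lp.fourierTransformₗᵢ Plane Spinor).symm.toContinuousLinearEquiv.toContinuousLinearMap ∘L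
    (evolution m t ∘L bessel hs)

theorem toPhysical_apply (m t : ℝ) (g : L2) :
    toPhysical hs m t g = 𝓕⁻ (evolution m t (bessel hs g)) := rfl

theorem fourier_toPhysical (m t : ℝ) (g : L2) :
    (𝓕 (toPhysical hs m t g) : L2) = bessel hs (evolution m t g) := by
  rw [toPhysical_apply, FourierTransform.fourier_fourierInv_eq, bessel_evolution]

theorem norm_toPhysical (m t : ℝ) (g : L2) : ‖toPhysical hs m t g‖ = ‖bessel hs g‖ := by
  rw [← Lp.norm_fourier_eq, fourier_toPhysical, bessel_evolution, norm_evolution]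

theorem toPhysical_injective (m t : ℝ) : Function.Injective (toPhysical hs m t) := by
  intro g g' h
  have h1 := congrArg (fun f : L2 ↦ (𝓕 f : L2)) h
  simp only [fourier_toPhysical] at h1
  have h2 := bessel_injective hs h1
  rw [← evolution_neg_evolution m t g, h2, evolution_neg_evolution]

/-- The integrand of the integral equation is the vector field of the interaction picture. -/
theorem I_smul_duhamelIntegrand (m t τ : ℝ) {ψ : ℝ → L2} {g : L2}
    (h : ψ τ = toPhysical hs m τ g) :
    Complex.I • duhamelIntegrand m b ψ t τ = toPhysical hs m t (field hs hb m τ g) := by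
  rw [field, map_smul, map_smul, duhamelIntegrand, h, propagator_eq, toPhysical_apply,
    toPhysical_apply, ← bessel_evolution, ← bessel_hartreeMap, bessel_evolution,
    evolution_evolution, ← sub_eq_add_neg]

include hb in
theorem continuousOn_duhamelIntegrand (m t : ℝ) {ψ g : ℝ → L2} {S : Set ℝ}
    (hg : ContinuousOn g S) (h : ∀ τ ∈ S, ψ τ = toPhysical hs m τ (g τ)) :
    ContinuousOn (fun τ ↦ Complex.I • duhamelIntegrand m b ψ t τ) S := by
  have h1 : ContinuousOn (fun τ ↦ toPhysical hs m t (field hs hb m τ (g τ))) S :=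
    (toPhysical hs m t).continuous.comp_continuousOn (continuousOn_field hs hb m hg)
  exact h1.congr fun τ hτ ↦ I_smul_duhamelIntegrand hs hb m t τ (h τ hτ)

include hb in
theorem intervalIntegrable_duhamelIntegrand (m : ℝ) {t : ℝ} (ht : 0 ≤ t) {ψ g : ℝ → L2}
    (hg : ContinuousOn g (Icc 0 t)) (h : ∀ τ ∈ Icc 0 t, ψ τ = toPhysical hs m τ (g τ)) :
    IntervalIntegrable (duhamelIntegrand m b ψ t) volume 0 t := by
  have h1 := (continuousOn_duhamelIntegrand hs hb m t hg h).const_smul (-Complex.I)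
  have h2 : ContinuousOn (duhamelIntegrand m b ψ t) (Icc 0 t) := by
    refine h1.congr fun τ _ ↦ ?_
    simp [smul_smul]
  exact h2.intervalIntegrable_of_Icc ht

/-- For a continuous curve, the integral equation is equivalent to the one in the interaction
picture. -/
theorem duhamel_eq_iff (m : ℝ) {t : ℝ} (ht : 0 ≤ t) {ψ g : ℝ → L2} {ψ₀ g₀ : L2}
    (hg : ContinuousOn g (Icc 0 t)) (h : ∀ τ ∈ Icc 0 t, ψ τ = toPhysical hs m τ (g τ))
    (h0 : (𝓕 ψ₀ : L2) = bessel hs g₀) :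
    ψ t = propagator m t ψ₀ + Complex.I • ∫ τ in (0 : ℝ)..t, duhamelIntegrand m b ψ t τ ↔
      g t = g₀ + ∫ τ in (0 : ℝ)..t, field hs hb m τ (g τ) := by
  have hint : IntervalIntegrable (fun τ ↦ field hs hb m τ (g τ)) volume 0 t :=
    (continuousOn_field hs hb m hg).intervalIntegrable_of_Icc ht
  have e1 : Complex.I • ∫ τ in (0 : ℝ)..t, duhamelIntegrand m b ψ t τ
      = toPhysical hs m t (∫ τ in (0 : ℝ)..t, field hs hb m τ (g τ)) := by
    rw [← intervalIntegral.integral_smul,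
      ← ContinuousLinearMap.intervalIntegral_comp_comm _ hint]
    refine intervalIntegral.integral_congr fun τ hτ ↦ ?_
    rw [uIcc_of_le ht] at hτ
    exact I_smul_duhamelIntegrand hs hb m t τ (h τ hτ)
  have e2 : propagator m t ψ₀ = toPhysical hs m t g₀ := by
    rw [propagator_eq, h0, toPhysical_apply]
  rw [e1, e2, h t ⟨ht, le_rfl⟩, ← map_add]
  exact (toPhysical_injective hs m t).eq_iff

theorem hsNorm_toPhysical_sub (m t r : ℝ) (g g' : L2) :
    hsNorm s (toPhysical hs m t g - toPhysical hs m r g')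
      = ‖evolution m t g - evolution m r g'‖ₑ := by
  refine hsNorm_of_fourier_eq_bessel hs ?_
  have h : ∀ f f' : L2, (𝓕 (f - f') : L2) = 𝓕 f - 𝓕 f' :=
    map_sub (Lp.fourierTransformₗᵢ Plane Spinor)
  rw [h, fourier_toPhysical, fourier_toPhysical, map_sub]

theorem continuousInHs_iff (m : ℝ) {ψ g : ℝ → L2}
    (h : ∀ t, 0 ≤ t → ψ t = toPhysical hs m t (g t)) :
    ContinuousInHs s ψ ↔ ContinuousOn g (Ici 0) := by
  have hmem : ∀ t, 0 ≤ t → MemHs s (ψ t) := fun t ht ↦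
    (memHs_iff_exists_bessel hs).2 ⟨_, by rw [h t ht, fourier_toPhysical]⟩
  have hiff : ContinuousOn (fun t ↦ evolution m t (g t)) (Ici 0) ↔ ContinuousOn g (Ici 0) := by
    constructor
    · intro hc
      refine (continuousOn_evolution m continuous_neg.continuousOn hc).congr fun t _ ↦ ?_
      exact (evolution_neg_evolution m t (g t)).symm
    · exact continuousOn_evolution m continuousOn_id
  rw [← hiff, ContinuousInHs, and_iff_right hmem]
  refine forall₂_congr fun t₀ ht₀ ↦ ?_
  rw [ContinuousWithinAt, tendsto_iff_edist_tendsto_0]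
  refine tendsto_congr' ?_
  filter_upwards [self_mem_nhdsWithin] with t ht
  rw [edist_eq_enorm_sub, h t ht, h t₀ ht₀, hsNorm_toPhysical_sub]

end Field

/-! ### Solutions in the interaction picture -/

section Solutions

open Set Metric
open scoped NNReal

variable {s b : ℝ} (hs : 0 < s) (hb : 0 < b)

theorem hasDerivWithinAt_of_eq_integral_field (m : ℝ) {g : ℝ → L2} {g₀ : L2}
    (hg : ContinuousOn g (Ici 0))
    (h : ∀ t, 0 ≤ t → g t = g₀ + ∫ τ in (0 : ℝ)..t, field hs hb m τ (g τ)) (T : ℝ) :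
    ∀ t ∈ Icc 0 T, HasDerivWithinAt g (field hs hb m t (g t)) (Icc 0 T) t := by
  intro t ht
  have h0 : (0 : ℝ) ∈ Icc 0 T := ⟨le_rfl, ht.1.trans ht.2⟩
  refine (ODE.hasDerivWithinAt_picard_Icc (u := univ) h0
    (continuous_field_uncurry hs hb m).continuousOn (hg.mono Icc_subset_Ici_self)
    (fun _ _ ↦ mem_univ _) g₀ ht).congr (fun r hr ↦ ?_) ?_
  · rw [ODE.picard_apply, h r hr.1]
  · rw [ODE.picard_apply, h t ht.1]

theorem eq_integral_field_of_hasDerivWithinAt (m : ℝ) {g : ℝ → L2}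
    (hg : ∀ T, ∀ t ∈ Icc 0 T, HasDerivWithinAt g (field hs hb m t (g t)) (Icc 0 T) t)
    {t : ℝ} (ht : 0 ≤ t) : g t = g 0 + ∫ τ in (0 : ℝ)..t, field hs hb m τ (g τ) := by
  have h := ODE.picard_eq_of_hasDerivAt (f := field hs hb m) (α := g) (t₀ := 0) (t := t)
    (u := univ) (continuous_field_uncurry hs hb m).continuousOn
    (by rw [uIcc_of_le ht]; exact hg t) (mapsTo_univ _ _)
  rw [ODE.picard_apply] at h
  exact h.symm

/-- Every global solution is described by a solution of the differential equation in the
interaction picture. -/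
theorem IsGlobalSolution.exists_eq_toPhysical {m : ℝ} {ψ₀ g₀ : L2} {ψ : ℝ → L2}
    (h : IsGlobalSolution m b s ψ₀ ψ) (h0 : (𝓕 ψ₀ : L2) = bessel hs g₀) :
    ∃ g : ℝ → L2, g 0 = g₀ ∧ (∀ t, 0 ≤ t → ψ t = toPhysical hs m t (g t)) ∧
      ∀ T, ∀ t ∈ Icc 0 T, HasDerivWithinAt g (field hs hb m t (g t)) (Icc 0 T) t := by
  have hex : ∀ t, ∃ G : L2, 0 ≤ t → (𝓕 (ψ t) : L2) = bessel hs G := by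
    intro t
    by_cases ht : 0 ≤ t
    · obtain ⟨G, hG⟩ := (memHs_iff_exists_bessel hs).1 (h.1.1 t ht)
      exact ⟨G, fun _ ↦ hG⟩
    · exact ⟨0, fun h ↦ absurd h ht⟩
  choose G hG using hex
  have hψ : ∀ t, 0 ≤ t → ψ t = toPhysical hs m t (evolution m (-t) (G t)) := by
    intro t ht
    rw [toPhysical_apply, ← bessel_evolution, evolution_evolution_neg, ← hG t ht]
    exact (FourierTransform.fourierInv_fourier_eq _).symm
  have hc := (continuousInHs_iff hs m hψ).1 h.1
  have hint : ∀ t, 0 ≤ t → evolution m (-t) (G t)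
      = g₀ + ∫ τ in (0 : ℝ)..t, field hs hb m τ (evolution m (-τ) (G τ)) := fun t ht ↦
    (duhamel_eq_iff hs hb m ht (hc.mono Icc_subset_Ici_self) (fun τ hτ ↦ hψ τ hτ.1) h0).1
      (h.2 t ht)
  refine ⟨fun t ↦ evolution m (-t) (G t), ?_, hψ,
    hasDerivWithinAt_of_eq_integral_field hs hb m hc hint⟩
  have := hint 0 le_rfl
  rwa [intervalIntegral.integral_same, add_zero] at this

theorem isGlobalSolution_toPhysical (m : ℝ) {ψ₀ : L2} {g : ℝ → L2}
    (h0 : (𝓕 ψ₀ : L2) = bessel hs (g 0))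
    (hg : ∀ T, ∀ t ∈ Icc 0 T, HasDerivWithinAt g (field hs hb m t (g t)) (Icc 0 T) t) :
    IsGlobalSolution m b s ψ₀ (fun t ↦ toPhysical hs m t (g t)) ∧
      IntegralsConverge m b (fun t ↦ toPhysical hs m t (g t)) := by
  have hcI : ∀ t, ContinuousOn g (Icc 0 t) := fun t r hr ↦ (hg t r hr).continuousWithinAt
  have hc : ContinuousOn g (Ici 0) := by
    intro t ht
    refine ((hcI (t + 1)) t ⟨ht, (lt_add_one t).le⟩).mono_of_mem_nhdsWithin ?_
    filter_upwards [self_mem_nhdsWithin, mem_nhdsWithin_of_mem_nhds (Iio_mem_nhds (lt_add_one t))]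
      with r h1 h2 using ⟨h1, h2.le⟩
  refine ⟨⟨(continuousInHs_iff hs m fun _ _ ↦ rfl).2 hc, fun t ht ↦ ?_⟩, fun t ht ↦ ⟨?_, ?_⟩⟩
  · exact (duhamel_eq_iff hs hb m ht (hcI t) (fun _ _ ↦ rfl) h0).2
      (eq_integral_field_of_hasDerivWithinAt hs hb m hg ht)
  · rw [potentialFourier_eq, fourier_toPhysical]
    exact integrable_potentialHat hb (lt_min hs two_pos) (min_le_right s 2)
      (l2_bessel_ne_top hs (min_le_left s 2) _)
  · exact intervalIntegrable_duhamelIntegrand hs hb m ht (hcI t) fun _ _ ↦ rfl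

end Solutions

end DiracHartree

end

theorem theorem1 (m b s : ℝ) (hm : 0 < m) (hb : 0 < b) (hs : 0 < s)
    (ψ₀ : DiracHartree.L2) (hψ₀ : DiracHartree.MemHs s ψ₀) :
    ∃ ψ : ℝ → DiracHartree.L2,
      DiracHartree.IsGlobalSolution m b s ψ₀ ψ ∧
      DiracHartree.IntegralsConverge m b ψ ∧
      (∀ t, 0 ≤ t → ‖ψ t‖ = ‖ψ₀‖) ∧
      ∀ φ : ℝ → DiracHartree.L2, DiracHartree.IsGlobalSolution m b s ψ₀ φ →
        ∀ t, 0 ≤ t → φ t = ψ t := by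
  obtain ⟨g₀, hg₀⟩ := (DiracHartree.memHs_iff_exists_bessel hs).1 hψ₀
  have hLip := DiracHartree.lipschitzOnWith_field hs hb m
  obtain ⟨g, h0, hg, hnorm⟩ := DiracHartree.exists_global_solution
    ((DiracHartree.bessel hs).restrictScalars ℝ)
    (fun x ↦ (DiracHartree.continuous_field_uncurry hs hb m).comp
      (continuous_id.prodMk continuous_const))
    hLip (DiracHartree.norm_field_le hs hb m) (DiracHartree.re_inner_bessel_field hs hb m) g₀
  have hsol := DiracHartree.isGlobalSolution_toPhysical hs hb m (by rw [h0]; exact hg₀) hg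
  refine ⟨fun t ↦ DiracHartree.toPhysical hs m t (g t), hsol.1, hsol.2, fun t ht ↦ ?_,
    fun φ hφ t ht ↦ ?_⟩
  · rw [DiracHartree.norm_toPhysical, ← Lp.norm_fourier_eq ψ₀, hg₀]
    exact hnorm t ht
  · obtain ⟨g', h0', hφg, hg'⟩ := hφ.exists_eq_toPhysical hs hb hg₀
    have := DiracHartree.eqOn_of_lipschitzOn_balls hLip (hg' t) (hg t) (h0'.trans h0.symm)
      ⟨ht, le_rfl⟩
    rw [hφg t ht, this]
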